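/- Let $M$ be a smooth manifold of dimension $m\ge 2$, let $TM$ be its tangent bundle and $T^2M$ the manifold of second-order velocities (2-jets $J^2_0\zeta$ at $0$ of curves $\zeta:\mathbb{R}\to M$). A chart $(V,\psi)$, $\psi=(x^i)$, of $M$ induces charts $(t,x^i,\dot x^i)$ on $\mathbb{R}\times TM$ and $(t,x^i,\dot x^i,\ddot x^i)$ on $\mathbb{R}\times T^2M$, the latter with domain $\mathbb{R}\times V^2$, where $V^2\subset T^2M$ is the preimage of $V$. Put $\omega^i=dx^i-\dot x^i\,dt$ and $\dot\omega^i=d\dot x^i-\ddot x^i\,dt$; the summation convention is used. For a 2-form $\rho$ on $\mathbb{R}\times TM$, let $(\pi^{2,1})^*\rho=p_1\rho+p_2\rho$ be the decomposition of its pull-back to $\mathbb{R}\times T^2M$ into its 1-contact component $p_1\rho$ (locally spanned by $\omega^i\wedge dt,\ \dot\omega^i\wedge dt$) and its 2-contact component $p_2\rho$ (locally spanned by $\omega^i\wedge\omega^j,\ \omega^i\wedge\dot\omega^j,\ \dot\omega^i\wedge\dot\omega^j$). Let $\varepsilon$ be a source form on $\mathbb{R}\times T^2M$, i.e. a 2-form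 which in every chart is $\varepsilon=\varepsilon_i\,\omega^i\wedge dt$ with smooth functions $\varepsilon_i=\varepsilon_i(x,\dot x,\ddot x)$ on $V^2$. Suppose that $\varepsilon$ is locally variational: around every point of $M$ there are a chart and a smooth function $\mathscr L(t,x,\dot x,\ddot x)$ on $\mathbb{R}\times V^2$ such that $$\varepsilon_i=\frac{\partial\mathscr L}{\partial x^i}-\frac{d}{dt}\frac{\partial\mathscr L}{\partial\dot x^i}+\frac{d^2}{dt^2}\frac{\partial\mathscr L}{\partial\ddot x^i}.$$ Let $\alpha_\varepsilon$ be the Lepage equivalent of $\varepsilon$, i.e. the closed 2-form on $\mathbb{R}\times TM$ with $p_1\alpha_\varepsilon=\varepsilon$. Then there is a unique decomposition of $\alpha_\varepsilon$ on $\mathbb{R}\times TM$, $$\alpha_\varepsilon=\alpha_0\wedge dt+\alpha',$$ where $\alpha_0$ and $\alpha'$ are closed forms (of degree 1 and 2) defined on $TM$ (and pulled back to $\mathbb{R}\times TM$). Moreover, in every chart $(V,\psi)$ of $M$ one has $\varepsilon_i=A_i+B_{ij}\ddot x^j$ with $A_i=\varepsilon_i|_{\ddot x=0}$ and $B_{ij}=\frac{\partial\varepsilon_i}{\partial\ddot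 x^j}\big|_{\ddot x=0}$, which are functions of $(x,\dot x)$, and $$\alpha_0=\left(A_i-\frac12\left(\frac{\partial A_i}{\partial\dot x^j}-\frac{\partial A_j}{\partial\dot x^i}\right)\dot x^j\right)dx^i+B_{ij}\dot x^j\,d\dot x^i,$$ $$\alpha'=\frac14\left(\frac{\partial A_i}{\partial\dot x^j}-\frac{\partial A_j}{\partial\dot x^i}\right)dx^i\wedge dx^j+B_{ij}\,dx^i\wedge d\dot x^j.$$ -/

import Mathlib

open scoped Manifold ContDiff

noncomputable section

namespace LepageMech

/-- The coordinate space `ℝ^m`. -/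
abbrev Coord (m : ℕ) : Type := EuclideanSpace ℝ (Fin m)

/-! ### Second order velocities -/

/-- Prolongation of a map `f` to second order velocities:
`(x, x', x'') ↦ (f x, Df x', D²f (x', x') + Df x'')`. -/
def prolong {E : Type*} [NormedAddCommGroup E] [NormedSpace ℝ E] (f : E → E)
    (p : E × E × E) : E × E × E :=
  (f p.1, fderiv ℝ f p.1 p.2.1,
    fderiv ℝ (fderiv ℝ f) p.1 p.2.1 p.2.1 + fderiv ℝ f p.1 p.2.2)

theorem prolong_contDiffOn {E : Type*} [NormedAddCommGroup E] [NormedSpace ℝ E] {f : E → E}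
    {s : Set E} (hs : IsOpen s) (hf : ContDiffOn ℝ ∞ f s) :
    ContDiffOn ℝ ∞ (prolong f) (s ×ˢ Set.univ) := by
  have h1 : ContDiffOn ℝ ∞ (fderiv ℝ f) s := hf.fderiv_of_isOpen hs le_rfl
  have h2 : ContDiffOn ℝ ∞ (fderiv ℝ (fderiv ℝ f)) s := h1.fderiv_of_isOpen hs le_rfl
  have hm : Set.MapsTo (Prod.fst : E × E × E → E) (s ×ˢ Set.univ) s := fun p hp => hp.1
  have h0' := hf.comp contDiff_fst.contDiffOn hm
  have h1' := h1.comp contDiff_fst.contDiffOn hm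
  have h2' := h2.comp contDiff_fst.contDiffOn hm
  have hv : ContDiffOn ℝ ∞ (fun p : E × E × E => p.2.1) (s ×ˢ Set.univ) :=
    (contDiff_fst.comp contDiff_snd).contDiffOn
  have ha : ContDiffOn ℝ ∞ (fun p : E × E × E => p.2.2) (s ×ˢ Set.univ) :=
    (contDiff_snd.comp contDiff_snd).contDiffOn
  exact h0'.prodMk ((h1'.clm_apply hv).prodMk (((h2'.clm_apply hv).clm_apply hv).add
    (h1'.clm_apply ha)))

/-- Value, velocity and acceleration at `0` of a curve in a vector space. -/
def curveData {E : Type*} [NormedAddCommGroup E] [NormedSpace ℝ E] (c : ℝ → E) : E × E × E :=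
  (c 0, deriv c 0, deriv (deriv c) 0)

theorem curveData_congr {E : Type*} [NormedAddCommGroup E] [NormedSpace ℝ E] {c d : ℝ → E}
    (h : c =ᶠ[nhds 0] d) : curveData c = curveData d := by
  simp only [curveData, h.eq_of_nhds, h.deriv_eq, h.deriv.deriv_eq]

theorem two_le_smooth : (2 : WithTop ℕ∞) ≤ ∞ := by
  have h : ((2 : ℕ∞) : WithTop ℕ∞) ≤ ((⊤ : ℕ∞) : WithTop ℕ∞) := WithTop.coe_le_coe.2 le_top
  exact h

theorem curveData_comp {E : Type*} [NormedAddCommGroup E] [NormedSpace ℝ E] {f : E → E}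
    {c : ℝ → E} (hc : ContDiffAt ℝ ∞ c 0) (hf : ContDiffAt ℝ ∞ f (c 0)) :
    curveData (f ∘ c) = prolong f (curveData c) := by
  have hc2 : ContDiffAt ℝ 2 c 0 := hc.of_le two_le_smooth
  have hf2 : ContDiffAt ℝ 2 f (c 0) := hf.of_le two_le_smooth
  have ec : ∀ᶠ t in nhds (0 : ℝ), DifferentiableAt ℝ c t :=
    (hc2.eventually (by simp)).mono fun t ht => ht.differentiableAt (by simp)
  have ef : ∀ᶠ t in nhds (0 : ℝ), DifferentiableAt ℝ f (c t) :=
    hc2.continuousAt.eventually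
      ((hf2.eventually (by simp)).mono fun t ht => ht.differentiableAt (by simp))
  have hd : deriv (f ∘ c) =ᶠ[nhds 0] fun t => fderiv ℝ f (c t) (deriv c t) := by
    filter_upwards [ec, ef] with t h1 h2
    exact fderiv_comp_deriv t h2 h1
  have hdc : DifferentiableAt ℝ (deriv c) 0 := by
    have : ContDiffAt ℝ 1 (fderiv ℝ c) 0 := hc2.fderiv_right (by norm_num)
    exact ((this.clm_apply contDiffAt_const).differentiableAt (by simp) :
      DifferentiableAt ℝ (fun t => fderiv ℝ c t 1) 0)
  have hdf : DifferentiableAt ℝ (fderiv ℝ f) (c 0) :=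
    (hf2.fderiv_right (m := 1) (by norm_num)).differentiableAt (by simp)
  have h1 : HasDerivAt (fun t => fderiv ℝ f (c t)) (fderiv ℝ (fderiv ℝ f) (c 0) (deriv c 0)) 0 :=
    hdf.hasFDerivAt.comp_hasDerivAt 0 ec.self_of_nhds.hasDerivAt
  have h2 := h1.clm_apply hdc.hasDerivAt
  simp only [curveData, prolong, hd.deriv_eq, h2.deriv, hd.eq_of_nhds, Function.comp]

/-- The quadratic curve with prescribed value, velocity and acceleration at `0`. -/
def quadCurve {E : Type*} [NormedAddCommGroup E] [NormedSpace ℝ E] (p : E × E × E) (t : ℝ) : E :=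
  p.1 + t • p.2.1 + (t ^ 2 / 2) • p.2.2

theorem quadCurve_zero {E : Type*} [NormedAddCommGroup E] [NormedSpace ℝ E] (p : E × E × E) :
    quadCurve p 0 = p.1 := by
  simp [quadCurve]

theorem quadCurve_contDiff {E : Type*} [NormedAddCommGroup E] [NormedSpace ℝ E]
    (p : E × E × E) : ContDiff ℝ ∞ (quadCurve p) := by
  unfold quadCurve
  fun_prop

theorem curveData_quadCurve {E : Type*} [NormedAddCommGroup E] [NormedSpace ℝ E]
    (p : E × E × E) : curveData (quadCurve p) = p := by
  have h1 : deriv (quadCurve p) = fun t => p.2.1 + t • p.2.2 := by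
    funext t
    have a : HasDerivAt (fun t : ℝ => t • p.2.1) ((1 : ℝ) • p.2.1) t :=
      (hasDerivAt_id t).smul_const _
    have b : HasDerivAt (fun t : ℝ => (t ^ 2 / 2) • p.2.2) (((2 * t) / 2) • p.2.2) t := by
      have := ((hasDerivAt_pow 2 t).div_const 2).smul_const p.2.2
      simpa using this
    have := ((hasDerivAt_const t p.1).add a).add b
    have e := this.deriv
    simp only [zero_add, one_smul, mul_div_cancel_left₀ t (two_ne_zero' ℝ)] at e
    exact e
  have h2 : deriv (fun t : ℝ => p.2.1 + t • p.2.2) 0 = p.2.2 := by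
    have := (hasDerivAt_const (0 : ℝ) p.2.1).add ((hasDerivAt_id (0 : ℝ)).smul_const p.2.2)
    have e := this.deriv
    simp only [zero_add, one_smul] at e
    exact e
  simp only [curveData, h1, h2, quadCurve_zero, zero_smul, add_zero]

section Velocities

variable (m : ℕ) (M : Type*) [TopologicalSpace M] [ChartedSpace (Coord m) M]

/-- Curves `ℝ → M` that are smooth at the origin. -/
abbrev SmoothCurve : Type _ := {ζ : ℝ → M // ContMDiffAt 𝓘(ℝ, ℝ) (𝓡 m) ∞ ζ 0}

/-- The set of all smooth charts of `M`. -/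
abbrev charts : Set (OpenPartialHomeomorph M (Coord m)) := IsManifold.maximalAtlas (𝓡 m) ∞ M

variable {m M}

/-- The coordinates `(x, x', x'')` of the 2-jet at `0` of a curve in a chart. -/
def jetCoord (ψ : OpenPartialHomeomorph M (Coord m)) (ζ : SmoothCurve m M) :
    Coord m × Coord m × Coord m :=
  curveData (ψ ∘ ζ.1)

variable (m M)

/-- Two curves have the same 2-jet at `0`: they agree at `0`, and so do their first and second
derivatives at `0` in every chart around this point. -/
def jetSetoid : Setoid (SmoothCurve m M) where
  r γ δ := γ.1 0 = δ.1 0 ∧ ∀ ψ ∈ charts m M, γ.1 0 ∈ ψ.source → jetCoord ψ γ = jetCoord ψ δ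
  iseqv :=
    { refl := fun _ => ⟨rfl, fun _ _ _ => rfl⟩
      symm := fun h => ⟨h.1.symm, fun ψ hψ hx => (h.2 ψ hψ (h.1 ▸ hx)).symm⟩
      trans := fun h k => ⟨h.1.trans k.1, fun ψ hψ hx =>
        (h.2 ψ hψ hx).trans (k.2 ψ hψ (h.1 ▸ hx))⟩ }

/-- The manifold `T²M` of second order velocities: 2-jets at `0` of curves `ℝ → M`. -/
def T2 : Type _ := Quotient (jetSetoid m M)

variable {m M}

/-- The 2-jet at `0` of a curve. -/
def T2.mk (γ : SmoothCurve m M) : T2 m M := Quotient.mk (jetSetoid m M) γ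

/-- A representative of a second order velocity. -/
def T2.curve (j : T2 m M) : SmoothCurve m M := Quotient.out j

theorem T2.mk_curve (j : T2 m M) : T2.mk j.curve = j := Quotient.out_eq j

theorem T2.curve_mk (γ : SmoothCurve m M) :
    (T2.mk γ).curve.1 0 = γ.1 0 ∧ ∀ ψ ∈ charts m M, γ.1 0 ∈ ψ.source →
      jetCoord ψ (T2.mk γ).curve = jetCoord ψ γ := by
  have h : (jetSetoid m M).r (T2.mk γ).curve γ := Quotient.exact (Quotient.out_eq (T2.mk γ))
  exact ⟨h.1, fun ψ hψ hx => h.2 ψ hψ (h.1 ▸ hx)⟩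

theorem transition_contDiffOn {ψ φ : OpenPartialHomeomorph M (Coord m)} (hψ : ψ ∈ charts m M)
    (hφ : φ ∈ charts m M) : ContDiffOn ℝ ∞ (φ ∘ ψ.symm) (ψ.symm.trans φ).source := by
  rw [← contMDiffOn_iff_contDiffOn]
  refine (contMDiffOn_of_mem_maximalAtlas hφ).comp
    ((contMDiffOn_symm_of_mem_maximalAtlas hψ).mono ?_) ?_
  · intro x hx; exact hx.1
  · intro x hx; exact hx.2

theorem curve_contDiffAt {ψ : OpenPartialHomeomorph M (Coord m)} (hψ : ψ ∈ charts m M)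
    (γ : SmoothCurve m M) (h : γ.1 0 ∈ ψ.source) : ContDiffAt ℝ ∞ (ψ ∘ γ.1) 0 := by
  rw [← contMDiffAt_iff_contDiffAt]
  exact (contMDiffAt_of_mem_maximalAtlas hψ h).comp 0 γ.2

theorem jetCoord_trans {ψ φ : OpenPartialHomeomorph M (Coord m)} (hψ : ψ ∈ charts m M)
    (hφ : φ ∈ charts m M) (γ : SmoothCurve m M) (h1 : γ.1 0 ∈ ψ.source)
    (h2 : γ.1 0 ∈ φ.source) :
    jetCoord φ γ = prolong (φ ∘ ψ.symm) (jetCoord ψ γ) := by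
  have hs : (ψ ∘ γ.1) 0 ∈ (ψ.symm.trans φ).source := by
    simp [h1, h2]
  rw [jetCoord, jetCoord, ← curveData_comp (curve_contDiffAt hψ γ h1)
    ((transition_contDiffOn hψ hφ).contDiffAt
      ((ψ.symm.trans φ).open_source.mem_nhds hs))]
  apply curveData_congr
  filter_upwards [γ.2.continuousAt.eventually (ψ.open_source.mem_nhds h1)] with t ht
  simp [ψ.left_inv ht]

/-- The jet of a curve is determined by its coordinates in one chart. -/
theorem T2.ext_chart {ψ : OpenPartialHomeomorph M (Coord m)} (hψ : ψ ∈ charts m M)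
    {γ δ : SmoothCurve m M} (h1 : γ.1 0 ∈ ψ.source) (h2 : δ.1 0 ∈ ψ.source)
    (h : jetCoord ψ γ = jetCoord ψ δ) : T2.mk γ = T2.mk δ := by
  have h0 : γ.1 0 = δ.1 0 := ψ.injOn h1 h2 (congrArg Prod.fst h)
  refine Quotient.sound ⟨h0, fun φ hφ hx => ?_⟩
  rw [jetCoord_trans hψ hφ γ h1 hx, jetCoord_trans hψ hφ δ h2 (h0 ▸ hx), h]

open Classical in
/-- The curve with given coordinates `(x, x', x'')` in a chart (constant if `x` is not in the
target of the chart). -/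
def curveOfCoord (ψ : OpenPartialHomeomorph M (Coord m)) (hψ : ψ ∈ charts m M)
    (p : Coord m × Coord m × Coord m) : SmoothCurve m M :=
  if hp : p.1 ∈ ψ.target then
    ⟨ψ.symm ∘ quadCurve p, by
      have h0 : quadCurve p 0 ∈ ψ.target := by rwa [quadCurve_zero]
      exact (contMDiffAt_symm_of_mem_maximalAtlas hψ h0).comp 0
        (quadCurve_contDiff p).contMDiff.contMDiffAt⟩
  else ⟨fun _ => ψ.symm p.1, contMDiffAt_const⟩

theorem curveOfCoord_zero (ψ : OpenPartialHomeomorph M (Coord m)) (hψ : ψ ∈ charts m M)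
    (p : Coord m × Coord m × Coord m) : (curveOfCoord ψ hψ p).1 0 = ψ.symm p.1 := by
  unfold curveOfCoord
  split_ifs
  · exact congrArg ψ.symm (quadCurve_zero p)
  · rfl

theorem jetCoord_curveOfCoord (ψ : OpenPartialHomeomorph M (Coord m)) (hψ : ψ ∈ charts m M)
    {p : Coord m × Coord m × Coord m} (hp : p.1 ∈ ψ.target) :
    jetCoord ψ (curveOfCoord ψ hψ p) = p := by
  refine Eq.trans (curveData_congr ?_) (curveData_quadCurve p)
  have h0 : quadCurve p 0 ∈ ψ.target := by rwa [quadCurve_zero]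
  filter_upwards [(quadCurve_contDiff p).continuous.continuousAt.eventually
    (ψ.open_target.mem_nhds h0)] with t ht
  simp [curveOfCoord, hp, ψ.right_inv ht]

/-- The chart `ψ² = (x, x', x'')` of `T²M` associated with a chart `ψ = (x)` of `M`. -/
def chart2 (ψ : OpenPartialHomeomorph M (Coord m)) (hψ : ψ ∈ charts m M) :
    PartialEquiv (T2 m M) (Coord m × Coord m × Coord m) where
  toFun j := jetCoord ψ j.curve
  invFun p := T2.mk (curveOfCoord ψ hψ p)
  source := {j | j.curve.1 0 ∈ ψ.source}
  target := ψ.target ×ˢ Set.univ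
  map_source' j hj := ⟨ψ.map_source hj, trivial⟩
  map_target' p hp := by
    change (T2.mk (curveOfCoord ψ hψ p)).curve.1 0 ∈ ψ.source
    rw [(T2.curve_mk _).1, curveOfCoord_zero]
    exact ψ.map_target hp.1
  left_inv' j hj := by
    have ht : (jetCoord ψ j.curve).1 ∈ ψ.target := ψ.map_source hj
    conv_rhs => rw [← T2.mk_curve j]
    refine T2.ext_chart hψ ?_ hj (jetCoord_curveOfCoord ψ hψ ht)
    rw [curveOfCoord_zero]
    exact ψ.map_target ht
  right_inv' p hp := by
    have h : (curveOfCoord ψ hψ p).1 0 ∈ ψ.source := by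
      rw [curveOfCoord_zero]; exact ψ.map_target hp.1
    rw [(T2.curve_mk _).2 ψ hψ h, jetCoord_curveOfCoord ψ hψ hp.1]

theorem chart2_trans_source {ψ φ : OpenPartialHomeomorph M (Coord m)} (hψ : ψ ∈ charts m M)
    (hφ : φ ∈ charts m M) : ((chart2 ψ hψ).symm.trans (chart2 φ hφ)).source
      = (ψ.symm.trans φ).source ×ˢ Set.univ := by
  ext p
  change (p ∈ ψ.target ×ˢ Set.univ ∧ (T2.mk (curveOfCoord ψ hψ p)).curve.1 0 ∈ φ.source) ↔ _
  rw [(T2.curve_mk _).1, curveOfCoord_zero]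
  simp

theorem chart2_trans_contDiffOn {ψ φ : OpenPartialHomeomorph M (Coord m)}
    (hψ : ψ ∈ charts m M) (hφ : φ ∈ charts m M) :
    ContDiffOn ℝ ∞ ((chart2 ψ hψ).symm.trans (chart2 φ hφ))
      ((chart2 ψ hψ).symm.trans (chart2 φ hφ)).source := by
  rw [chart2_trans_source]
  refine (prolong_contDiffOn (ψ.symm.trans φ).open_source
    (transition_contDiffOn hψ hφ)).congr ?_
  rintro p ⟨hp, -⟩
  have h1 : (curveOfCoord ψ hψ p).1 0 ∈ ψ.source := by
    rw [curveOfCoord_zero]; exact ψ.map_target hp.1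
  have h2 : (curveOfCoord ψ hψ p).1 0 ∈ φ.source := by
    rw [curveOfCoord_zero]; exact hp.2
  change jetCoord φ (T2.mk (curveOfCoord ψ hψ p)).curve = _
  rw [(T2.curve_mk _).2 φ hφ h2, jetCoord_trans hψ hφ _ h1 h2, jetCoord_curveOfCoord ψ hψ hp.1]

variable (m M)

/-- The smooth atlas of `T²M` formed by the charts associated with the charts of `M`. -/
def T2.core [IsManifold (𝓡 m) ∞ M] :
    ChartedSpaceCore (Coord m × Coord m × Coord m) (T2 m M) where
  atlas := {e | ∃ ψ, ∃ hψ : ψ ∈ charts m M, e = chart2 ψ hψ}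
  chartAt j := chart2 (chartAt (Coord m) (j.curve.1 0)) (IsManifold.chart_mem_maximalAtlas _)
  mem_chart_source j := mem_chart_source (Coord m) (j.curve.1 0)
  chart_mem_atlas j := ⟨_, IsManifold.chart_mem_maximalAtlas _, rfl⟩
  open_source := by
    rintro _ _ ⟨ψ, hψ, rfl⟩ ⟨φ, hφ, rfl⟩
    rw [chart2_trans_source]
    exact (ψ.symm.trans φ).open_source.prod isOpen_univ
  continuousOn_toFun := by
    rintro _ _ ⟨ψ, hψ, rfl⟩ ⟨φ, hφ, rfl⟩
    exact (chart2_trans_contDiffOn hψ hφ).continuousOn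

instance T2.topologicalSpace [IsManifold (𝓡 m) ∞ M] : TopologicalSpace (T2 m M) :=
  (T2.core m M).toTopologicalSpace

instance T2.chartedSpace [IsManifold (𝓡 m) ∞ M] :
    ChartedSpace (Coord m × Coord m × Coord m) (T2 m M) :=
  (T2.core m M).toChartedSpace

instance T2.isManifold [IsManifold (𝓡 m) ∞ M] :
    IsManifold 𝓘(ℝ, Coord m × Coord m × Coord m) ∞ (T2 m M) := by
  refine isManifold_of_contDiffOn _ _ _ ?_
  intro e e' he he'
  simp only [atlas, ChartedSpace.atlas, Set.mem_iUnion, Set.mem_singleton_iff] at he he'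
  obtain ⟨_, ⟨ψ, hψ, rfl⟩, rfl⟩ := he
  obtain ⟨_, ⟨φ, hφ, rfl⟩, rfl⟩ := he'
  simpa using! chart2_trans_contDiffOn hψ hφ

end Velocities

/-! ### Differential forms on manifolds without boundary -/

section Forms

variable {E H E' H' : Type*} [NormedAddCommGroup E] [NormedSpace ℝ E] [TopologicalSpace H]
  [NormedAddCommGroup E'] [NormedSpace ℝ E'] [TopologicalSpace H']

/-- (Not necessarily smooth) differential `k`-forms on a manifold `N`. -/
abbrev DForm (I : ModelWithCorners ℝ E H) (N : Type*) [TopologicalSpace N] [ChartedSpace H N]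
    (k : ℕ) : Type _ :=
  (p : N) → (TangentSpace I p) [⋀^Fin k]→L[ℝ] ℝ

/-- The pull-back `f^* ρ`. -/
def DForm.pullback {I : ModelWithCorners ℝ E H} {I' : ModelWithCorners ℝ E' H'}
    {N N' : Type*} [TopologicalSpace N] [ChartedSpace H N] [TopologicalSpace N']
    [ChartedSpace H' N'] {k : ℕ} (f : N → N') (ρ : DForm I' N' k) : DForm I N k :=
  fun p => (ρ (f p)).compContinuousLinearMap (mfderiv I I' f p)

/-- The expression in coordinates, with respect to a parametrization `f : E → N` (usually the
inverse of a chart), of a form on `N`, i.e. its pull-back by `f`. -/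
def DForm.coordExpr {I' : ModelWithCorners ℝ E' H'} {N' : Type*} [TopologicalSpace N']
    [ChartedSpace H' N'] {k : ℕ} (f : E → N') (ρ : DForm I' N' k) : E → E [⋀^Fin k]→L[ℝ] ℝ :=
  DForm.pullback (I := 𝓘(ℝ, E)) (I' := I') f ρ

variable {I : ModelWithCorners ℝ E H} {N : Type*} [TopologicalSpace N] [ChartedSpace H N] {k : ℕ}

/-- A form is smooth if its expression in every smooth chart is smooth. -/
def DForm.IsSmooth (ρ : DForm I N k) : Prop :=
  ∀ e ∈ IsManifold.maximalAtlas I ∞ N,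
    ContDiffOn ℝ ∞ (DForm.coordExpr (I' := I) (e.extend I).symm ρ) (e.extend I).target

/-- A form is closed if its expression in every smooth chart has zero exterior derivative. -/
def DForm.IsClosed (ρ : DForm I N k) : Prop :=
  ∀ e ∈ IsManifold.maximalAtlas I ∞ N, ∀ y ∈ (e.extend I).target,
    extDeriv (DForm.coordExpr (I' := I) (e.extend I).symm ρ) y = 0

end Forms

section Wedge

variable {V : Type*} [AddCommGroup V] [Module ℝ V] [TopologicalSpace V]

/-- An alternating `1`-form considered as a linear form. -/
def linForm (a : V [⋀^Fin 1]→L[ℝ] ℝ) : V →L[ℝ] ℝ :=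
  (ContinuousAlternatingMap.ofSubsingleton ℝ V ℝ (0 : Fin 1)).symm a

/-- The exterior product of two linear forms, `(a ∧ b)(u, v) = a(u) b(v) - a(v) b(u)`. -/
def wedge (a b : V →L[ℝ] ℝ) : V [⋀^Fin 2]→L[ℝ] ℝ where
  toFun v := a (v 0) * b (v 1) - a (v 1) * b (v 0)
  map_update_add' v i x y := by
    fin_cases i <;> simp [Function.update] <;> ring
  map_update_smul' v i c x := by
    fin_cases i <;> simp [Function.update] <;> ring
  cont := by
    fun_prop
  map_eq_zero_of_eq' v i j h hij := by
    fin_cases i <;> fin_cases j <;> simp_all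

end Wedge

/-! ### Contact structure of `ℝ × T²M` -/

section Contact

variable {m : ℕ} {M : Type*} [TopologicalSpace M] [ChartedSpace (Coord m) M]

/-- The velocity `ζ'(s)` of a curve in `M`, as a point of `TM`. -/
def velocity (ζ : SmoothCurve m M) (s : ℝ) : TangentBundle (𝓡 m) M :=
  ⟨ζ.1 s, mfderiv 𝓘(ℝ, ℝ) (𝓡 m) ζ.1 s (1 : ℝ)⟩

variable [IsManifold (𝓡 m) ∞ M]

variable (m M) in
/-- Differential `k`-forms on `TM`. -/
abbrev FormTM (k : ℕ) : Type _ := DForm (𝓡 m).tangent (TangentBundle (𝓡 m) M) k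

variable (m M) in
/-- Differential `k`-forms on `ℝ × TM`. -/
abbrev FormRTM (k : ℕ) : Type _ :=
  DForm (𝓘(ℝ, ℝ).prod (𝓡 m).tangent) (ℝ × TangentBundle (𝓡 m) M) k

variable (m M) in
/-- Differential `k`-forms on `ℝ × T²M`. -/
abbrev FormRT2M (k : ℕ) : Type _ :=
  DForm (𝓘(ℝ, ℝ).prod 𝓘(ℝ, Coord m × Coord m × Coord m)) (ℝ × T2 m M) k

/-- The jet projection `π^{2,1} : ℝ × T²M → ℝ × TM`. -/
def proj21 (p : ℝ × T2 m M) : ℝ × TangentBundle (𝓡 m) M := (p.1, velocity p.2.curve 0)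

/-- The tangent map `Tπ^{2,1}` at a point of `ℝ × T²M`. -/
def tproj21 (p : ℝ × T2 m M) :
    TangentSpace (𝓘(ℝ, ℝ).prod 𝓘(ℝ, Coord m × Coord m × Coord m)) p →L[ℝ]
      TangentSpace (𝓘(ℝ, ℝ).prod (𝓡 m).tangent) (proj21 p) :=
  mfderiv (𝓘(ℝ, ℝ).prod 𝓘(ℝ, Coord m × Coord m × Coord m))
    (𝓘(ℝ, ℝ).prod (𝓡 m).tangent) proj21 p

/-- The horizontal component `ξ ↦ T(J¹γ)(Tπ² ξ)` of tangent vectors at a point `(t, J²ζ)` of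
`ℝ × T²M`, where `γ` is the section `s ↦ (s, ζ(s - t))` of `ℝ × M`; in a chart
`T(J¹γ)(∂/∂t) = ∂/∂t + x' ∂/∂x + x'' ∂/∂x'`. -/
def horiz (p : ℝ × T2 m M) :
    TangentSpace (𝓘(ℝ, ℝ).prod 𝓘(ℝ, Coord m × Coord m × Coord m)) p →L[ℝ]
      TangentSpace (𝓘(ℝ, ℝ).prod (𝓡 m).tangent) (proj21 p) :=
  ContinuousLinearMap.comp
    (mfderiv 𝓘(ℝ, ℝ) (𝓘(ℝ, ℝ).prod (𝓡 m).tangent)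
      (fun s : ℝ => ((s, velocity p.2.curve (s - p.1)) : ℝ × TangentBundle (𝓡 m) M)) p.1)
    (mfderiv (𝓘(ℝ, ℝ).prod 𝓘(ℝ, Coord m × Coord m × Coord m)) 𝓘(ℝ, ℝ) Prod.fst p)

/-- The `2`-contact component `p₂ρ` of a `2`-form `ρ` on `ℝ × TM`: `ρ` evaluated on the contact
components `Tπ^{2,1} ξ - hξ` of both arguments. In a chart, it is the component of `(π^{2,1})^*ρ`
spanned by exterior products of two of the contact forms `dxⁱ - x'ⁱ dt`, `dx'ⁱ - x''ⁱ dt`. -/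
def twoContact (ρ : FormRTM m M 2) : FormRT2M m M 2 :=
  fun p => (ρ (proj21 p)).compContinuousLinearMap (tproj21 p - horiz p)

/-- The `1`-contact component `p₁ρ` of a `2`-form `ρ` on `ℝ × TM`,
`(π^{2,1})^*ρ = p₁ρ + p₂ρ`. -/
def oneContact (ρ : FormRTM m M 2) : FormRT2M m M 2 :=
  fun p => DForm.pullback proj21 ρ p - twoContact ρ p

end Contact

/-! ### Source forms, local variationality, Lepage equivalents -/

section Source

variable {m : ℕ}

/-- The `i`-th vector of the standard basis of `ℝ^m`. -/
abbrev bas (i : Fin m) : Coord m := EuclideanSpace.single i 1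

/-- `dt` in the coordinates `(t, x, x', x'')`. -/
def dt2 : (ℝ × Coord m × Coord m × Coord m) →L[ℝ] ℝ := ContinuousLinearMap.fst ℝ _ _

/-- The contact form `ωⁱ = dxⁱ - x'ⁱ dt` at the point `(t, x, x', x'')`. -/
def contact2 (i : Fin m) (p : ℝ × Coord m × Coord m × Coord m) :
    (ℝ × Coord m × Coord m × Coord m) →L[ℝ] ℝ :=
  (EuclideanSpace.proj i).comp
    ((ContinuousLinearMap.fst ℝ _ _).comp (ContinuousLinearMap.snd ℝ ℝ _))
    - p.2.2.1 i • dt2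

variable {M : Type*} [TopologicalSpace M] [ChartedSpace (Coord m) M]

/-- Inverse of the chart `id × ψ²` of `ℝ × T²M`. -/
def param2 (ψ : OpenPartialHomeomorph M (Coord m)) (hψ : ψ ∈ charts m M)
    (p : ℝ × Coord m × Coord m × Coord m) : ℝ × T2 m M :=
  (p.1, (chart2 ψ hψ).symm p.2)

/-- Inverse of the chart `ψ¹ = (x, x')` of `TM` associated with a chart `ψ = (x)` of `M`. -/
def param1 (ψ : OpenPartialHomeomorph M (Coord m)) (p : Coord m × Coord m) :
    TangentBundle (𝓡 m) M :=
  ⟨ψ.symm p.1, mfderiv 𝓘(ℝ, Coord m) (𝓡 m) ψ.symm p.1 p.2⟩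

variable [IsManifold (𝓡 m) ∞ M]

/-- The coefficient `εᵢ` of a `2`-form `ε` on `ℝ × T²M` at `ωⁱ ∧ dt` in a chart, at `t = 0`. -/
def srcCoeff (ε : FormRT2M m M 2) (ψ : OpenPartialHomeomorph M (Coord m)) (hψ : ψ ∈ charts m M)
    (i : Fin m) (q : Coord m × Coord m × Coord m) : ℝ :=
  DForm.coordExpr (param2 ψ hψ) ε (0, q) ![(0, bas i, 0, 0), (1, 0, 0, 0)]

/-- (Autonomous) source forms on `ℝ × T²M`: in every chart, `ε = ∑ᵢ εᵢ ωⁱ ∧ dt` where the `εᵢ` are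
smooth functions of `(x, x', x'')`. -/
def IsSourceForm (ε : FormRT2M m M 2) : Prop :=
  ∀ (ψ : OpenPartialHomeomorph M (Coord m)) (hψ : ψ ∈ charts m M),
    (∀ i, ContDiffOn ℝ ∞ (srcCoeff ε ψ hψ i) (ψ.target ×ˢ Set.univ)) ∧
    ∀ p : ℝ × Coord m × Coord m × Coord m, p.2.1 ∈ ψ.target →
      DForm.coordExpr (param2 ψ hψ) ε p =
        ∑ i, srcCoeff ε ψ hψ i p.2 • wedge (contact2 i p) dt2

/-- The formal total derivative `d/dt = ∂/∂t + ∑ₖ x^{(k+1)} ∂/∂x^{(k)}` of a function of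
`(t, x, x', …, x^{(r)})`, which is a function of `(t, x, x', …, x^{(r+1)})`. -/
def totalDeriv {r : ℕ} (f : ℝ × (Fin (r + 1) → Coord m) → ℝ) :
    ℝ × (Fin (r + 2) → Coord m) → ℝ :=
  fun p => fderiv ℝ f (p.1, fun k => p.2 k.castSucc) (1, fun k => p.2 k.succ)

/-- The partial derivative `∂f/∂x^{(k)i}` of a function of `(t, x, x', …, x^{(r)})`. -/
def jetPartial {r : ℕ} (k : Fin (r + 1)) (i : Fin m) (f : ℝ × (Fin (r + 1) → Coord m) → ℝ) :
    ℝ × (Fin (r + 1) → Coord m) → ℝ :=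
  fun p => fderiv ℝ f p (0, Pi.single k (bas i))

/-- The Euler–Lagrange expressions
`Eᵢ(L) = ∂L/∂xⁱ - d/dt ∂L/∂x'ⁱ + d²/dt² ∂L/∂x''ⁱ` of a function `L` of `(t, x, x', x'')`. -/
def eulerLagrange (L : ℝ × (Fin 3 → Coord m) → ℝ) (i : Fin m) (p : ℝ × (Fin 5 → Coord m)) : ℝ :=
  jetPartial 0 i L (p.1, fun k => p.2 (k.castLE (by norm_num)))
    - totalDeriv (jetPartial 1 i L) (p.1, fun k => p.2 (k.castLE (by norm_num)))
    + totalDeriv (totalDeriv (jetPartial 2 i L)) p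

/-- A source form is locally variational if around every point of `M` there are a chart `(V, ψ)`
and a Lagrange function on `ℝ × V²` whose Euler–Lagrange expressions are the `εᵢ`. -/
def IsLocallyVariational (ε : FormRT2M m M 2) : Prop :=
  ∀ x : M, ∃ (ψ : OpenPartialHomeomorph M (Coord m)) (hψ : ψ ∈ charts m M), x ∈ ψ.source ∧
    ∃ L : ℝ × (Fin 3 → Coord m) → ℝ, ContDiffOn ℝ ∞ L {p | p.2 0 ∈ ψ.target} ∧
      ∀ (i : Fin m) (p : ℝ × (Fin 5 → Coord m)), p.2 0 ∈ ψ.target →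
        srcCoeff ε ψ hψ i (p.2 0, p.2 1, p.2 2) = eulerLagrange L i p

/-- `α` is the Lepage equivalent of the source form `ε`: a closed (smooth) `2`-form on `ℝ × TM`
with `p₁α = ε`. -/
structure IsLepageEquivalent (ε : FormRT2M m M 2) (α : FormRTM m M 2) : Prop where
  smooth : DForm.IsSmooth α
  closed : DForm.IsClosed α
  oneContact_eq : oneContact α = ε

/-! ### The decomposition -/

/-- `α₀` and `α'` are closed (smooth) forms on `TM` with `α = α₀ ∧ dt + α'`. -/
structure IsClosedDecomposition (α : FormRTM m M 2) (α₀ : FormTM m M 1) (α' : FormTM m M 2) :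
    Prop where
  smooth_zero : DForm.IsSmooth α₀
  closed_zero : DForm.IsClosed α₀
  smooth_prime : DForm.IsSmooth α'
  closed_prime : DForm.IsClosed α'
  eq : ∀ p : ℝ × TangentBundle (𝓡 m) M,
    α p = wedge (linForm (DForm.pullback Prod.snd α₀ p))
        (mfderiv (𝓘(ℝ, ℝ).prod (𝓡 m).tangent) 𝓘(ℝ, ℝ) Prod.fst p)
      + DForm.pullback Prod.snd α' p

/-- `Aᵢ(x, x') = εᵢ(x, x', 0)`. -/
def coeffA (ε : FormRT2M m M 2) (ψ : OpenPartialHomeomorph M (Coord m)) (hψ : ψ ∈ charts m M)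
    (i : Fin m) (q : Coord m × Coord m) : ℝ :=
  srcCoeff ε ψ hψ i (q.1, q.2, 0)

/-- `Bᵢⱼ(x, x') = ∂εᵢ/∂x''ʲ (x, x', 0)`. -/
def coeffB (ε : FormRT2M m M 2) (ψ : OpenPartialHomeomorph M (Coord m)) (hψ : ψ ∈ charts m M)
    (i j : Fin m) (q : Coord m × Coord m) : ℝ :=
  fderiv ℝ (srcCoeff ε ψ hψ i) (q.1, q.2, 0) (0, 0, bas j)

/-- `∂Aᵢ/∂x'ʲ - ∂Aⱼ/∂x'ⁱ`. -/
def curlA (ε : FormRT2M m M 2) (ψ : OpenPartialHomeomorph M (Coord m)) (hψ : ψ ∈ charts m M)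
    (i j : Fin m) (q : Coord m × Coord m) : ℝ :=
  fderiv ℝ (coeffA ε ψ hψ i) q (0, bas j) - fderiv ℝ (coeffA ε ψ hψ j) q (0, bas i)

/-- `dxⁱ` in the coordinates `(x, x')`. -/
def dx (i : Fin m) : (Coord m × Coord m) →L[ℝ] ℝ :=
  (EuclideanSpace.proj i).comp (ContinuousLinearMap.fst ℝ (Coord m) (Coord m))

/-- `dx'ⁱ` in the coordinates `(x, x')`. -/
def dv (i : Fin m) : (Coord m × Coord m) →L[ℝ] ℝ :=
  (EuclideanSpace.proj i).comp (ContinuousLinearMap.snd ℝ (Coord m) (Coord m))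

end Source

end LepageMech

end

open LepageMech

/-! In a chart write `β` for the expression of `α` in the coordinates `(t, x, x')`, and let `D =
∂/∂t + x' ∂/∂x + x'' ∂/∂x'`. Since `D` has no contact component, `p₁α = ε` says that `β(ξ, D) = εᵢ
dxⁱ(ξ)` for every `ξ` without `∂/∂t` part and for every value of `x''` (`isLocalLepage`). But `β`
does not contain `x''`, so comparing two accelerations shows that `εᵢ` is affine in `x''`, that its
slope `Bᵢⱼ` is the `dxⁱ ∧ dx'ʲ` component of `β`, and that `β` has no `dx' ∧ dx'` component
(`pairing_acc`, `pairing_vel_vel`). Setting `x'' = 0` expresses `β(ξ, ∂/∂t)` through `Aᵢ` and the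
spatial part of `β` (`pairing_time`).

What remains unknown is the `dx ∧ dx` component `F`, and `dβ = 0` determines it. On `(∂/∂t, ∂/∂x',
∂/∂x')` closedness gives the symmetry of `B` (`pairing_pos_vel_comm`). On `(∂/∂t, ∂/∂x, ∂/∂x')` and
`(∂/∂x, x' ∂/∂x, ∂/∂x')` it gives `Fᵢⱼ = ∂Aᵢ/∂x'ʲ - x'ᵏ ∂Bᵢⱼ/∂xᵏ`, whose antisymmetric part is half
the curl of `A` in `x'` (`two_mul_pairing_pos_pos`).

Thus `β` is determined by `ε`, which is autonomous, so `α` is invariant under time translation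
(`time_indep`, `formAt_time_indep`). Then `α₀ = -i_{∂/∂t} α` and `α' = α|_{t=0}` live on `TM`. The
form `α'` is closed as a pull-back of `α`, and `α₀` is closed by Cartan's formula, as the Lie
derivative of `α` along `∂/∂t` vanishes. Uniqueness is linear algebra at each point of `t = 0`, and
the coordinate formulas are read off from `A`, `B` and `F`. -/

noncomputable section

namespace LepageMech

/-! ### Bilinear calculus of 2-forms on a normed space -/

section Calculus

variable {P : Type*} [NormedAddCommGroup P] [NormedSpace ℝ P]

/-- A `2`-form as a bilinear map. -/
def pairing (a : P [⋀^Fin 2]→L[ℝ] ℝ) : P →ₗ[ℝ] P →ₗ[ℝ] ℝ :=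
  LinearMap.mk₂ ℝ (fun u v => a ![u, v])
    (fun u u' v => a.vecCons_add ![v] u u')
    (fun c u v => a.vecCons_smul ![v] c u)
    (fun u v v' => by
      have h := a.map_update_add ![u, v] 1 v v'
      have e (w : P) : Function.update ![u, v] 1 w = ![u, w] := by
        ext i; fin_cases i <;> rfl
      simpa [e] using h)
    (fun c u v => by
      have h := a.map_update_smul ![u, v] 1 c v
      have e (w : P) : Function.update ![u, v] 1 w = ![u, w] := by
        ext i; fin_cases i <;> rfl
      simpa [e] using h)

theorem pairing_apply (a : P [⋀^Fin 2]→L[ℝ] ℝ) (u v : P) : pairing a u v = a ![u, v] := rfl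

theorem pairing_swap (a : P [⋀^Fin 2]→L[ℝ] ℝ) (u v : P) : pairing a u v = -pairing a v u := by
  have h := a.map_swap ![v, u] (i := 0) (j := 1) (by simp)
  have e : ![v, u] ∘ Equiv.swap (0 : Fin 2) 1 = ![u, v] := by
    ext i; fin_cases i <;> rfl
  rw [e] at h
  exact h

theorem form_two_ext {a b : P [⋀^Fin 2]→L[ℝ] ℝ} (h : ∀ u v, pairing a u v = pairing b u v) :
    a = b := by
  ext w
  have e : w = ![w 0, w 1] := by
    ext i; fin_cases i <;> rfl
  rw [e]
  exact h _ _

theorem pairing_comp {Q : Type*} [NormedAddCommGroup Q] [NormedSpace ℝ Q] (a : Q [⋀^Fin 2]→L[ℝ] ℝ) (L : P →L[ℝ] Q) (u v : P) :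
    pairing (a.compContinuousLinearMap L) u v = pairing a (L u) (L v) := by
  have e : ⇑L ∘ ![u, v] = ![L u, L v] := by
    ext i; fin_cases i <;> rfl
  exact congrArg a e

theorem pairing_add (a b : P [⋀^Fin 2]→L[ℝ] ℝ) (u v : P) :
    pairing (a + b) u v = pairing a u v + pairing b u v := rfl

theorem pairing_sub (a b : P [⋀^Fin 2]→L[ℝ] ℝ) (u v : P) :
    pairing (a - b) u v = pairing a u v - pairing b u v := rfl

theorem pairing_smul (c : ℝ) (a : P [⋀^Fin 2]→L[ℝ] ℝ) (u v : P) :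
    pairing (c • a) u v = c * pairing a u v := rfl

theorem pairing_sum {ι : Type*} (s : Finset ι) (a : ι → P [⋀^Fin 2]→L[ℝ] ℝ) (u v : P) :
    pairing (∑ i ∈ s, a i) u v = ∑ i ∈ s, pairing (a i) u v := by
  simp [pairing_apply]

theorem pairing_wedge (a b : P →L[ℝ] ℝ) (u v : P) :
    pairing (wedge a b) u v = a u * b v - a v * b u := rfl

theorem hasFDerivAt_pairing {β : P → P [⋀^Fin 2]→L[ℝ] ℝ} {p : P} (hβ : DifferentiableAt ℝ β p)
    (u v : P) : ∃ D : P →L[ℝ] ℝ, HasFDerivAt (fun z => pairing (β z) u v) D p ∧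
      ∀ w, D w = pairing (fderiv ℝ β p w) u v :=
  ⟨_, hβ.hasFDerivAt.continuousAlternatingMap_apply
    (fun i : Fin 2 => hasFDerivAt_const ((![u, v] : Fin 2 → P) i) p), fun w => by
      simp [pairing_apply]⟩

theorem differentiableAt_pairing {β : P → P [⋀^Fin 2]→L[ℝ] ℝ} {p : P}
    (hβ : DifferentiableAt ℝ β p) (u v : P) :
    DifferentiableAt ℝ (fun z => pairing (β z) u v) p :=
  let ⟨_, h, _⟩ := hasFDerivAt_pairing hβ u v
  h.differentiableAt

theorem fderiv_pairing {β : P → P [⋀^Fin 2]→L[ℝ] ℝ} {p : P} (hβ : DifferentiableAt ℝ β p)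
    (u v w : P) : fderiv ℝ (fun z => pairing (β z) u v) p w = pairing (fderiv ℝ β p w) u v := by
  obtain ⟨D, h, hD⟩ := hasFDerivAt_pairing hβ u v
  rw [h.fderiv, hD]

/-- The derivative of the contraction of a `2`-form with a constant and a linear vector field. -/
theorem fderiv_pairing_linear {β : P → P [⋀^Fin 2]→L[ℝ] ℝ} {p : P}
    (hβ : DifferentiableAt ℝ β p) (u : P) (N : P →L[ℝ] P) :
    DifferentiableAt ℝ (fun z => pairing (β z) u (N z)) p ∧
      ∀ w, fderiv ℝ (fun z => pairing (β z) u (N z)) p w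
        = pairing (fderiv ℝ β p w) u (N p) + pairing (β p) u (N w) := by
  have h := hβ.hasFDerivAt.continuousAlternatingMap_apply
    (g := fun i => ![fun _ => u, fun z => N z] i) (g' := fun i => ![0, N] i) (x := p) (by
      intro i
      fin_cases i
      · exact hasFDerivAt_const u p
      · exact N.hasFDerivAt)
  have e : ∀ z : P, (fun i : Fin 2 => (![fun _ => u, fun z => N z] : Fin 2 → P → P) i z)
      = ![u, N z] := by
    intro z; ext i; fin_cases i <;> rfl
  simp only [e] at h
  refine ⟨h.differentiableAt, fun w => ?_⟩
  simp only [pairing_apply]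
  rw [h.fderiv]
  have e' : Function.update ![u, N p] 1 (N w) = ![u, N w] := by
    ext i; fin_cases i <;> rfl
  simpa [Fin.sum_univ_two] using congrArg (β p) e'

/-- Closedness of a `2`-form evaluated on three vectors. -/
theorem pairing_closed {β : P → P [⋀^Fin 2]→L[ℝ] ℝ} {p : P} (hβ : DifferentiableAt ℝ β p)
    (hd : extDeriv β p = 0) (u v w : P) :
    pairing (fderiv ℝ β p u) v w - pairing (fderiv ℝ β p v) u w
      + pairing (fderiv ℝ β p w) u v = 0 := by
  have h := (extDeriv_apply hβ ![u, v, w]).trans (Fin.sum_univ_three _)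
  rw [hd] at h
  have e0 : (0 : Fin 3).removeNth ![u, v, w] = ![v, w] := by
    ext i; fin_cases i <;> rfl
  have e1 : (1 : Fin 3).removeNth ![u, v, w] = ![u, w] := by
    ext i; fin_cases i <;> rfl
  have e2 : (2 : Fin 3).removeNth ![u, v, w] = ![u, v] := by
    ext i; fin_cases i <;> rfl
  have f (a b c : P) : fderiv ℝ (fun z => β z ![a, b]) p c = pairing (fderiv ℝ β p c) a b :=
    fderiv_pairing hβ a b c
  simp only [e0, e1, e2, f] at h
  simp at h
  linarith

end Calculus

/-! ### Local analysis: symmetry of `B` and the `dx ∧ dx` component -/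

section Local

variable {E : Type*} [NormedAddCommGroup E] [NormedSpace ℝ E]

/-- The linear vector field `(t, x, x') ↦ x' ∂/∂x`. -/
def velField : (ℝ × E × E) →L[ℝ] (ℝ × E × E) :=
  (ContinuousLinearMap.inr ℝ ℝ (E × E)).comp ((ContinuousLinearMap.inl ℝ E E).comp
    ((ContinuousLinearMap.snd ℝ E E).comp (ContinuousLinearMap.snd ℝ ℝ (E × E))))

@[simp] theorem velField_apply (p : ℝ × E × E) : velField p = (0, p.2.2, 0) := rfl

/-- A closed `2`-form `β` on `ℝ × U × E` such that contraction with the vectors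
`∂/∂t + x' ∂/∂x + x'' ∂/∂x'` gives a linear form `e(x, x', x'')` in `dx` only. -/
structure IsLocalLepage (U : Set E) (e : E × E × E → E →ₗ[ℝ] ℝ)
    (β : ℝ × E × E → (ℝ × E × E) [⋀^Fin 2]→L[ℝ] ℝ) : Prop where
  isOpen : IsOpen U
  diff : ∀ p, p.2.1 ∈ U → DifferentiableAt ℝ β p
  closed : ∀ p, p.2.1 ∈ U → extDeriv β p = 0
  key : ∀ p : ℝ × E × E, p.2.1 ∈ U → ∀ X Y a : E,
    pairing (β p) (0, X, Y) (1, p.2.2, a) = e (p.2.1, p.2.2, a) X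

namespace IsLocalLepage

variable {U : Set E} {e : E × E × E → E →ₗ[ℝ] ℝ}
  {β : ℝ × E × E → (ℝ × E × E) [⋀^Fin 2]→L[ℝ] ℝ} (h : IsLocalLepage U e β)
include h

theorem eventually {p : ℝ × E × E} (hp : p.2.1 ∈ U) : ∀ᶠ z in nhds p, z.2.1 ∈ U :=
  (h.isOpen.preimage (by fun_prop : Continuous fun z : ℝ × E × E => z.2.1)).mem_nhds hp

/-- Two vectors `D` over the same `(t, x, x')` differ only by their acceleration, so subtracting
`key` at `0` from `key` at `a` isolates `(0, 0, a)`. The left side is linear in `a`, which makes `e`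
affine in `x''`; the right side does not contain `Y`. -/
theorem pairing_acc {p : ℝ × E × E} (hp : p.2.1 ∈ U) (X Y a : E) :
    pairing (β p) (0, X, Y) (0, 0, a) = e (p.2.1, p.2.2, a) X - e (p.2.1, p.2.2, 0) X := by
  rw [← h.key p hp X Y a, ← h.key p hp X Y 0, ← map_sub]
  simp

theorem pairing_vel_vel {p : ℝ × E × E} (hp : p.2.1 ∈ U) (Y a : E) :
    pairing (β p) (0, 0, Y) (0, 0, a) = 0 := by
  simp [h.pairing_acc hp]

/-- This is `key` at zero acceleration, where `D = ∂/∂t + velField`. -/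
theorem pairing_time {p : ℝ × E × E} (hp : p.2.1 ∈ U) (X Y : E) :
    pairing (β p) (0, X, Y) (1, 0, 0)
      = e (p.2.1, p.2.2, 0) X - pairing (β p) (0, X, Y) (velField p) := by
  rw [← h.key p hp X Y 0, ← map_sub]
  simp only [velField_apply, Prod.mk_sub_mk, sub_zero, sub_self]
  rfl

/-- Identities for the components of `β` hold on the open set `ℝ × U × E`, so they may be
differentiated there; this is the form in which all of them enter `dβ = 0`. -/
theorem fderiv_eq {p : ℝ × E × E} (hp : p.2.1 ∈ U) (u v : ℝ × E × E)
    {f : ℝ × E × E → ℝ} (hf : ∀ z : ℝ × E × E, z.2.1 ∈ U → pairing (β z) u v = f z)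
    (w : ℝ × E × E) : pairing (fderiv ℝ β p w) u v = fderiv ℝ f p w := by
  rw [← fderiv_pairing (h.diff p hp)]
  congr 1
  refine Filter.EventuallyEq.fderiv_eq ?_
  filter_upwards [h.eventually hp] with z hz using hf z hz

theorem fderiv_vel_vel {p : ℝ × E × E} (hp : p.2.1 ∈ U) (Y a : E) (w : ℝ × E × E) :
    pairing (fderiv ℝ β p w) (0, 0, Y) (0, 0, a) = 0 := by
  rw [h.fderiv_eq hp _ _ (f := fun _ => 0) (fun z hz => h.pairing_vel_vel hz Y a)]
  simp

/-- `∂Bᵢⱼ/∂x'ᵏ` is symmetric in `j`, `k`. -/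
theorem fderiv_pos_vel_comm {p : ℝ × E × E} (hp : p.2.1 ∈ U) (X Y Y' : E) :
    pairing (fderiv ℝ β p (0, 0, Y)) (0, X, 0) (0, 0, Y')
      = pairing (fderiv ℝ β p (0, 0, Y')) (0, X, 0) (0, 0, Y) := by
  have := pairing_closed (h.diff p hp) (h.closed p hp) (0, X, 0) (0, 0, Y) (0, 0, Y')
  rw [h.fderiv_vel_vel hp] at this
  linarith

/-- Differentiation of `pairing_time` with `X = 0`, where the term in `e` vanishes. The second
summand is there because `velField` depends on the point, linearly. -/
theorem fderiv_vel_time {p : ℝ × E × E} (hp : p.2.1 ∈ U) (Y : E) (w : ℝ × E × E) :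
    pairing (fderiv ℝ β p w) (0, 0, Y) (1, 0, 0) =
      -(pairing (fderiv ℝ β p w) (0, 0, Y) (velField p)
        + pairing (β p) (0, 0, Y) (velField w)) := by
  rw [h.fderiv_eq hp _ _ (f := fun z => -pairing (β z) (0, 0, Y) (velField z))
    (fun z hz => by rw [h.pairing_time hz]; simp)]
  rw [← (fderiv_pairing_linear (h.diff p hp) _ velField).2 w, fderiv_fun_neg]
  rfl

/-- `Bᵢⱼ = Bⱼᵢ`. -/
theorem pairing_pos_vel_comm {p : ℝ × E × E} (hp : p.2.1 ∈ U) (X Y : E) :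
    pairing (β p) (0, X, 0) (0, 0, Y) = pairing (β p) (0, Y, 0) (0, 0, X) := by
  -- After `fderiv_vel_time`, the derivatives of `x'` itself contribute `B(X, Y)` and `B(Y, X)`. The
  -- other two terms are derivatives of `B` contracted with `x'`, and they cancel by
  -- `fderiv_pos_vel_comm`.
  have h1 := pairing_closed (h.diff p hp) (h.closed p hp) (1, 0, 0) (0, 0, X) (0, 0, Y)
  rw [h.fderiv_vel_vel hp, pairing_swap _ (1, 0, 0), pairing_swap _ (1, 0, 0),
    h.fderiv_vel_time hp, h.fderiv_vel_time hp] at h1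
  have h2 := h.fderiv_pos_vel_comm hp p.2.2 X Y
  rw [pairing_swap, pairing_swap _ _ (0, 0, X)] at h2
  have h3 := pairing_swap (β p) (0, X, 0) (0, 0, Y)
  have h4 := pairing_swap (β p) (0, Y, 0) (0, 0, X)
  simp only [velField_apply] at h1
  linarith

theorem fderiv_time_pos_vel {p : ℝ × E × E} (hp : p.2.1 ∈ U) (X Y : E) :
    pairing (fderiv ℝ β p (1, 0, 0)) (0, X, 0) (0, 0, Y) = 0 := by
  rw [← fderiv_pairing (h.diff p hp)]
  have hd := differentiableAt_pairing (h.diff p hp) (0, X, 0) (0, 0, Y)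
  rw [← hd.lineDeriv_eq_fderiv, lineDeriv]
  -- By `pairing_acc` this component is a difference of values of `e`, which has no time argument;
  -- it is constant along the line.
  have : (fun t : ℝ => pairing (β (p + t • (1, 0, 0))) (0, X, 0) (0, 0, Y))
      = fun _ => e (p.2.1, p.2.2, Y) X - e (p.2.1, p.2.2, 0) X := by
    funext t
    rw [h.pairing_acc (by simpa using hp)]
    simp
  rw [this]
  simp

/-- The components of `β` at `dx ∧ dx`. -/
theorem two_mul_pairing_pos_pos {p : ℝ × E × E} (hp : p.2.1 ∈ U) (X Y : E) :
    2 * pairing (β p) (0, X, 0) (0, Y, 0)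
      = fderiv ℝ (fun q : E × E => e (q.1, q.2, 0) X) p.2 (0, Y)
        - fderiv ℝ (fun q : E × E => e (q.1, q.2, 0) Y) p.2 (0, X) := by
  have hs : ∀ X Y, pairing (fderiv ℝ β p (velField p)) (0, X, 0) (0, 0, Y)
      = pairing (fderiv ℝ β p (velField p)) (0, Y, 0) (0, 0, X) := fun X Y => by
    rw [h.fderiv_eq hp (0, X, 0) (0, 0, Y) (f := fun z => pairing (β z) (0, Y, 0) (0, 0, X))
      (fun z hz => h.pairing_pos_vel_comm hz X Y), fderiv_pairing (h.diff p hp)]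
  -- The derivative of `pairing_time` in the direction of `x'`: moving `x'` inside `velField`
  -- produces the undifferentiated component `β(X, Y)` that is to be computed.
  have hA : ∀ X Y : E, pairing (fderiv ℝ β p (0, 0, Y)) (0, X, 0) (1, 0, 0)
      = fderiv ℝ (fun q : E × E => e (q.1, q.2, 0) X) p.2 (0, Y)
        - (pairing (fderiv ℝ β p (0, 0, Y)) (0, X, 0) (velField p)
          + pairing (β p) (0, X, 0) (0, Y, 0)) := fun X Y => by
    have hN := fderiv_pairing_linear (h.diff p hp) (0, X, 0) velField
    have hT := differentiableAt_pairing (h.diff p hp) (0, X, 0) (1, 0, 0)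
    -- No differentiability of `e` is assumed. It follows for `e (x, x', 0) X` because this is a sum
    -- of two differentiable contractions of `β`, restricted to the slice of time `p.1`.
    have hG := hT.hasFDerivAt.add hN.1.hasFDerivAt
    have hi : HasFDerivAt (fun q : E × E => ((p.1, q) : ℝ × E × E))
        (ContinuousLinearMap.inr ℝ ℝ (E × E)) p.2 :=
      hasFDerivAt_prodMk_right p.1 p.2
    have hc := HasFDerivAt.comp p.2 (f := fun q : E × E => ((p.1, q) : ℝ × E × E)) hG hi
    have hA := hc.congr_of_eventuallyEq (f₁ := fun q : E × E => e (q.1, q.2, 0) X) (by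
      filter_upwards [(h.isOpen.preimage continuous_fst).mem_nhds hp] with q hq
      have := h.pairing_time (p := (p.1, q)) hq X 0
      simp only [Function.comp, Pi.add_apply]
      linarith)
    rw [hA.fderiv]
    simp only [ContinuousLinearMap.comp_apply, add_apply,
      ContinuousLinearMap.inr_apply]
    rw [hN.2, fderiv_pairing (h.diff p hp)]
    simp only [velField_apply]
    ring
  -- Closedness on `(∂/∂t, X, Y')` leaves derivatives of `β(Y', x')` along `X` and of `β(X, x')`
  -- along `Y'`. Closedness on `(X, x', Y')` merges them into the derivative of `B(X, Y)` along
  -- `velField`. That term is symmetric by `hs`, so it drops out on antisymmetrization.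
  have hF : ∀ X Y : E, pairing (β p) (0, X, 0) (0, Y, 0)
      = fderiv ℝ (fun q : E × E => e (q.1, q.2, 0) X) p.2 (0, Y)
        - pairing (fderiv ℝ β p (velField p)) (0, X, 0) (0, 0, Y) := fun X Y => by
    have h1 := pairing_closed (h.diff p hp) (h.closed p hp) (1, 0, 0) (0, X, 0) (0, 0, Y)
    rw [h.fderiv_time_pos_vel hp, pairing_swap _ (1, 0, 0), pairing_swap _ (1, 0, 0),
      h.fderiv_vel_time hp, hA] at h1
    have h2 := pairing_closed (h.diff p hp) (h.closed p hp) (0, X, 0) (velField p) (0, 0, Y)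
    rw [pairing_swap _ (velField p)] at h2
    have h3 : velField ((0, X, 0) : ℝ × E × E) = 0 := rfl
    rw [h3, map_zero] at h1
    linarith
  have h1 := hF X Y
  have h2 := hF Y X
  have h3 := pairing_swap (β p) (0, X, 0) (0, Y, 0)
  have h4 := hs X Y
  linarith

end IsLocalLepage
end Local

/-! ### Smoothness and closedness of forms along arbitrary smooth parametrizations -/

section FormsOnManifolds

variable {E H F F' : Type*} [NormedAddCommGroup E] [NormedSpace ℝ E] [TopologicalSpace H]
  [NormedAddCommGroup F] [NormedSpace ℝ F] [NormedAddCommGroup F'] [NormedSpace ℝ F']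
  {I : ModelWithCorners ℝ E H} {N : Type*} [TopologicalSpace N] [ChartedSpace H N] {k : ℕ}

/-- The value of a form as an alternating form on the model space. -/
def formAt (ρ : DForm I N k) (n : N) : E [⋀^Fin k]→L[ℝ] ℝ := ρ n

/-- The derivative of a map from a vector space to a manifold, as a map to the model space. -/
def mderiv (I : ModelWithCorners ℝ E H) (f : F → N) (z : F) : F →L[ℝ] E := mfderiv 𝓘(ℝ, F) I f z

theorem coordExpr_eq (ρ : DForm I N k) (f : F → N) (z : F) :
    DForm.coordExpr f ρ z = (formAt ρ (f z)).compContinuousLinearMap (mderiv I f z) := rfl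

theorem mderiv_congr {f g : F → N} {z : F} (h : f =ᶠ[nhds z] g) : mderiv I f z = mderiv I g z :=
  h.mfderiv_eq

theorem coordExpr_congr (ρ : DForm I N k) {f g : F → N} {z : F} (h : f =ᶠ[nhds z] g) :
    DForm.coordExpr f ρ z = DForm.coordExpr g ρ z := by
  rw [coordExpr_eq, coordExpr_eq, mderiv_congr h, h.eq_of_nhds]

theorem mderiv_comp {f : F → N} {g : F' → F} {z : F'} (hg : DifferentiableAt ℝ g z)
    (hf : MDifferentiableAt 𝓘(ℝ, F) I f (g z)) :
    mderiv I (f ∘ g) z = (mderiv I f (g z)).comp (fderiv ℝ g z) := by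
  have := mfderiv_comp z hf hg.mdifferentiableAt
  rw [mfderiv_eq_fderiv] at this
  exact this

theorem coordExpr_comp (ρ : DForm I N k) {f : F → N} {g : F' → F} {z : F'}
    (hg : DifferentiableAt ℝ g z) (hf : MDifferentiableAt 𝓘(ℝ, F) I f (g z)) :
    DForm.coordExpr (f ∘ g) ρ z
      = (DForm.coordExpr f ρ (g z)).compContinuousLinearMap (fderiv ℝ g z) := by
  rw [coordExpr_eq, coordExpr_eq, mderiv_comp hg hf]
  rfl

/-- A family of forms on a finite dimensional space is smooth if its values are smooth. -/
theorem contDiffAt_form [FiniteDimensional ℝ F] {β : F' → F [⋀^Fin k]→L[ℝ] ℝ} {z : F'}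
    {n : WithTop ℕ∞}
    (h : ∀ v : Fin k → F, ContDiffAt ℝ n (fun y => β y v) z) : ContDiffAt ℝ n β z := by
  -- `L` records the values on tuples of basis vectors. It is injective into a finite dimensional
  -- space, so a left inverse `R` is automatically continuous and recovers the form smoothly from
  -- its values.
  let L : (F [⋀^Fin k]→L[ℝ] ℝ) →ₗ[ℝ] (Fin k → Fin (Module.finrank ℝ F)) → ℝ :=
    { toFun := fun a s => a (fun i => Module.finBasis ℝ F (s i))
      map_add' := fun _ _ => rfl
      map_smul' := fun _ _ => rfl }
  have hL : LinearMap.ker L = ⊥ := by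
    refine LinearMap.ker_eq_bot.2 fun a b hab => ?_
    have h' : a.toMultilinearMap = b.toMultilinearMap :=
      Module.Basis.ext_multilinear (fun _ => Module.finBasis ℝ F) fun s => congrFun hab s
    ext v
    exact congrArg (fun c : MultilinearMap ℝ (fun _ : Fin k => F) ℝ => c v) h'
  obtain ⟨R, hR⟩ := LinearMap.exists_leftInverse_of_injective L hL
  have e : β = fun y => R.toContinuousLinearMap (L (β y)) := by
    funext y
    exact (LinearMap.congr_fun hR (β y)).symm
  rw [e]
  exact R.toContinuousLinearMap.contDiff.contDiffAt.comp z
    (contDiffAt_pi.2 fun s => h _)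

/-- Precomposition is linear in the form and continuous multilinear in the `k` linear maps inserted
in its slots, hence smooth in both; the pull-back puts the same map in each slot. -/
theorem contDiffAt_pullback [FiniteDimensional ℝ F] {β : F' → E [⋀^Fin k]→L[ℝ] ℝ}
    {g : F' → F →L[ℝ] E} {z : F'} {n : WithTop ℕ∞} (hβ : ContDiffAt ℝ n β z)
    (hg : ContDiffAt ℝ n g z) :
    ContDiffAt ℝ n (fun y => (β y).compContinuousLinearMap (g y)) z := by
  refine contDiffAt_form fun v => ?_
  let T : (E [⋀^Fin k]→L[ℝ] ℝ) →L[ℝ] (E [×k]→L[ℝ] ℝ) :=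
    ContinuousAlternatingMap.toContinuousMultilinearMapCLM ℝ
  have h1 : ContDiffAt ℝ n (fun y => T (β y)) z := T.contDiff.contDiffAt.comp z hβ
  have h2 := (ContinuousMultilinearMap.contDiff (n := n) (E := fun _ : Fin k => F →L[ℝ] E)
    (F := (E [×k]→L[ℝ] ℝ) →L[ℝ] (F [×k]→L[ℝ] ℝ))
    (ContinuousMultilinearMap.compContinuousLinearMapContinuousMultilinear ℝ
      (fun _ : Fin k => F) (fun _ : Fin k => E) ℝ)).contDiffAt.comp z
    (contDiffAt_pi.2 fun _ : Fin k => hg)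
  have h3 := h2.clm_apply h1
  exact (ContinuousMultilinearMap.apply ℝ (fun _ : Fin k => F) ℝ v).contDiff.contDiffAt.comp z h3

theorem eventually_mdifferentiableAt [IsManifold I ∞ N] {f : F → N} {y : F}
    (hf : ContMDiffAt 𝓘(ℝ, F) I ∞ f y) :
    ∀ᶠ z in nhds y, MDifferentiableAt 𝓘(ℝ, F) I f z := by
  -- Smoothness of order `∞` at a point need not hold at nearby points, whereas order `1` does.
  have h1 : ContMDiffAt 𝓘(ℝ, F) I 1 f y := hf.of_le (by exact_mod_cast le_top)
  have : IsManifold I 1 N := IsManifold.of_le (n := ∞) (by exact_mod_cast le_top)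
  filter_upwards [(contMDiffAt_iff_contMDiffAt_nhds (by simp)).1 h1] with z hz using hz.mdifferentiableAt (by simp)

theorem contMDiffAt_extend_symm [I.Boundaryless] {e : OpenPartialHomeomorph N H}
    (he : e ∈ IsManifold.maximalAtlas I ∞ N) {y : E} (hy : y ∈ (e.extend I).target) :
    ContMDiffAt 𝓘(ℝ, E) I ∞ (e.extend I).symm y := by
  have h := contMDiffOn_extend_symm he (I := I)
  rw [← e.extend_target'] at h
  exact h.contMDiffAt (e.isOpen_extend_target.mem_nhds hy)

variable [IsManifold I ∞ N] [I.Boundaryless]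

/-- Around a point where `f` is smooth, the expression of a form along `f` is the pull-back of the
expression of the form in a chart. -/
theorem exists_coordExpr_eventuallyEq (ρ : DForm I N k) {f : F → N} {y : F}
    (hf : ContMDiffAt 𝓘(ℝ, F) I ∞ f y) :
    ∃ e ∈ IsManifold.maximalAtlas I ∞ N, ∃ g : F → E, ContDiffAt ℝ ∞ g y ∧
      g y ∈ (e.extend I).target ∧ DForm.coordExpr f ρ =ᶠ[nhds y] fun z =>
        (DForm.coordExpr (I' := I) (e.extend I).symm ρ (g z)).compContinuousLinearMap
          (fderiv ℝ g z) := by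
  set e := chartAt H (f y)
  have he : e ∈ IsManifold.maximalAtlas I ∞ N := IsManifold.chart_mem_maximalAtlas _
  have hy : f y ∈ e.source := mem_chart_source H (f y)
  have hg : ContDiffAt ℝ ∞ (e.extend I ∘ f) y := by
    rw [← contMDiffAt_iff_contDiffAt]
    exact (e.contMDiffAt_extend he hy).comp y hf
  have hs : ∀ᶠ z in nhds y, f z ∈ e.source :=
    hf.continuousAt.eventually (e.open_source.mem_nhds hy)
  refine ⟨e, he, e.extend I ∘ f, hg, (e.extend I).map_source (by simpa using hy), ?_⟩
  have hd : ∀ᶠ z in nhds y, DifferentiableAt ℝ (e.extend I ∘ f) z :=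
    ((hg.of_le (m := 1) (by exact_mod_cast le_top)).eventually (by simp)).mono
      fun z hz => hz.differentiableAt (by simp)
  filter_upwards [hs.eventually_nhds, hd] with z hz hdz
  have hm : MDifferentiableAt 𝓘(ℝ, E) I (e.extend I).symm ((e.extend I ∘ f) z) := by
    have hz' : (e.extend I ∘ f) z ∈ (e.extend I).target :=
      (e.extend I).map_source (by simpa using hz.self_of_nhds)
    exact (contMDiffAt_extend_symm he hz').mdifferentiableAt (by simp)
  rw [← coordExpr_comp ρ hdz hm]
  apply coordExpr_congr
  filter_upwards [hz] with w hw
  exact (e.extend_left_inv (I := I) hw).symm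

theorem contDiffAt_coordExpr [FiniteDimensional ℝ F] {ρ : DForm I N k} (hρ : DForm.IsSmooth ρ)
    {f : F → N} {y : F} (hf : ContMDiffAt 𝓘(ℝ, F) I ∞ f y) :
    ContDiffAt ℝ ∞ (DForm.coordExpr (I' := I) f ρ) y := by
  obtain ⟨e, he, g, hg, hy, h⟩ := exists_coordExpr_eventuallyEq ρ hf
  refine ContDiffAt.congr_of_eventuallyEq ?_ h
  have h1 := (hρ e he).contDiffAt ((e.isOpen_extend_target (I := I)).mem_nhds hy)
  exact contDiffAt_pullback (h1.comp y hg) (hg.fderiv_right (by rfl))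

/-- The exterior derivative commutes with pull-back. The definition of closedness tests only
inverses of manifold charts; this extends it to any smooth `f`, in particular to `id × param1 ψ`. -/
theorem extDeriv_coordExpr {ρ : DForm I N k} (hρ : DForm.IsSmooth ρ) (hc : DForm.IsClosed ρ)
    {f : F → N} {y : F} (hf : ContMDiffAt 𝓘(ℝ, F) I ∞ f y) :
    extDeriv (DForm.coordExpr (I' := I) f ρ) y = 0 := by
  obtain ⟨e, he, g, hg, hy, h⟩ := exists_coordExpr_eventuallyEq ρ hf
  have h1 := (hρ e he).contDiffAt ((e.isOpen_extend_target (I := I)).mem_nhds hy)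
  rw [h.extDeriv_eq, extDeriv_pullback (h1.differentiableAt (by simp)) hg (by
    simpa [minSmoothness] using two_le_smooth), hc e he _ hy]
  rfl

end FormsOnManifolds

/-! ### The charts `(x, x')` of the tangent bundle -/

section Charts

variable {m : ℕ} {M : Type*} [TopologicalSpace M] [ChartedSpace (Coord m) M]

/-- The coordinates `(x, x')` on `TM` associated with a chart of `M`. -/
def coord1 (ψ : OpenPartialHomeomorph M (Coord m)) (w : TangentBundle (𝓡 m) M) :
    Coord m × Coord m :=
  (ψ w.1, (mfderiv (𝓡 m) 𝓘(ℝ, Coord m) ψ w.1 : _ →L[ℝ] Coord m) w.2)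

variable [IsManifold (𝓡 m) ∞ M]

theorem smooth_add_one : (∞ : WithTop ℕ∞) + 1 ≤ ∞ := by rfl

-- All tangent spaces are definitionally the model space, so the fibre components can be compared
-- without transport along `hx`.
omit [IsManifold (𝓡 m) ∞ M] in
theorem tangent_ext {x x' : M} (hx : x = x') {v v' : Coord m} (hv : v = v') :
    (⟨x, v⟩ : TangentBundle (𝓡 m) M) = ⟨x', v'⟩ := by
  subst hx hv
  rfl

variable {ψ : OpenPartialHomeomorph M (Coord m)} (hψ : ψ ∈ charts m M)
include hψ

omit [IsManifold (𝓡 m) ∞ M] in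
theorem mdifferentiableAt_chart {x : M} (hx : x ∈ ψ.source) :
    MDifferentiableAt (𝓡 m) 𝓘(ℝ, Coord m) ψ x :=
  (contMDiffAt_of_mem_maximalAtlas hψ hx).mdifferentiableAt (by simp)

omit [IsManifold (𝓡 m) ∞ M] in
theorem mdifferentiableAt_chart_symm {x : Coord m} (hx : x ∈ ψ.target) :
    MDifferentiableAt 𝓘(ℝ, Coord m) (𝓡 m) ψ.symm x :=
  (contMDiffAt_symm_of_mem_maximalAtlas hψ hx).mdifferentiableAt (by simp)

omit [IsManifold (𝓡 m) ∞ M] in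
theorem mfderiv_symm_mfderiv {x : M} (hx : x ∈ ψ.source) (v : TangentSpace (𝓡 m) x) :
    (mfderiv 𝓘(ℝ, Coord m) (𝓡 m) ψ.symm (ψ x) : Coord m →L[ℝ] Coord m)
      ((mfderiv (𝓡 m) 𝓘(ℝ, Coord m) ψ x : Coord m →L[ℝ] Coord m) v) = v := by
  have h := mfderiv_comp x (mdifferentiableAt_chart_symm hψ (ψ.map_source hx))
    (mdifferentiableAt_chart hψ hx)
  have h2 : mfderiv (𝓡 m) (𝓡 m) (ψ.symm ∘ ψ) x = mfderiv (𝓡 m) (𝓡 m) id x := by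
    apply Filter.EventuallyEq.mfderiv_eq
    filter_upwards [ψ.open_source.mem_nhds hx] with y hy using ψ.left_inv hy
  rw [h2, mfderiv_id] at h
  exact (DFunLike.congr_fun h v).symm

theorem param1_coord1 {w : TangentBundle (𝓡 m) M} (hw : w.1 ∈ ψ.source) :
    param1 ψ (coord1 ψ w) = w :=
  tangent_ext (ψ.left_inv hw) (mfderiv_symm_mfderiv hψ hw w.2)

/-- `param1 ψ` is the tangent map of `ψ.symm` preceded by the smooth identification of `ℝ^m × ℝ^m`
with the tangent bundle of `ℝ^m`. `coord1 ψ` is treated in the same way. -/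
theorem contMDiffAt_param1 {q : Coord m × Coord m} (hq : q.1 ∈ ψ.target) :
    ContMDiffAt 𝓘(ℝ, Coord m × Coord m) (𝓡 m).tangent ∞ (param1 ψ) q := by
  have h1 := (contMDiffOn_symm_of_mem_maximalAtlas hψ).contMDiffOn_tangentMapWithin
    smooth_add_one ψ.open_target.uniqueMDiffOn
  have h2 : ContMDiff 𝓘(ℝ, Coord m × Coord m) 𝓘(ℝ, Coord m).tangent ∞
      (fun q : Coord m × Coord m => (⟨q.1, q.2⟩ : TangentBundle 𝓘(ℝ, Coord m) (Coord m))) := by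
    rw [modelWithCornersSelf_prod]
    exact contMDiff_tangentBundleModelSpaceHomeomorph_symm (I := 𝓘(ℝ, Coord m)) (n := ∞)
  have h3 := h1.comp h2.contMDiffOn (s := {q : Coord m × Coord m | q.1 ∈ ψ.target})
    (fun q hq => hq)
  have ho : IsOpen {q : Coord m × Coord m | q.1 ∈ ψ.target} :=
    ψ.open_target.preimage continuous_fst
  refine (h3.contMDiffAt (ho.mem_nhds hq)).congr_of_eventuallyEq ?_
  filter_upwards [ho.mem_nhds hq] with z hz
  simp only [Function.comp, tangentMapWithin, param1]
  rw [mfderivWithin_of_isOpen ψ.open_target hz]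

theorem contMDiffAt_coord1 {w : TangentBundle (𝓡 m) M} (hw : w.1 ∈ ψ.source) :
    ContMDiffAt (𝓡 m).tangent 𝓘(ℝ, Coord m × Coord m) ∞ (coord1 ψ) w := by
  have h1 := (contMDiffOn_of_mem_maximalAtlas hψ).contMDiffOn_tangentMapWithin
    smooth_add_one ψ.open_source.uniqueMDiffOn
  have h2 : ContMDiff 𝓘(ℝ, Coord m).tangent 𝓘(ℝ, Coord m × Coord m) ∞
      (fun w : TangentBundle 𝓘(ℝ, Coord m) (Coord m) => ((w.1, w.2) : Coord m × Coord m)) := by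
    rw [modelWithCornersSelf_prod]
    exact contMDiff_tangentBundleModelSpaceHomeomorph (I := 𝓘(ℝ, Coord m)) (n := ∞)
  have h3 := h2.comp_contMDiffOn h1
  have ho : IsOpen {w : TangentBundle (𝓡 m) M | w.1 ∈ ψ.source} :=
    ψ.open_source.preimage (FiberBundle.continuous_proj (Coord m) (TangentSpace (𝓡 m)))
  refine (h3.contMDiffAt (ho.mem_nhds hw)).congr_of_eventuallyEq ?_
  filter_upwards [ho.mem_nhds hw] with z hz
  simp only [Function.comp, tangentMapWithin, coord1]
  rw [mfderivWithin_of_isOpen ψ.open_source hz]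

/-- The charts `ψ¹` are immersive parametrizations onto open sets. -/
theorem mderiv_param1_surjective {w : TangentBundle (𝓡 m) M} (hw : w.1 ∈ ψ.source) :
    Function.Surjective (mderiv (𝓡 m).tangent (param1 ψ) (coord1 ψ w)) := by
  have h1 := (contMDiffAt_coord1 hψ hw).mdifferentiableAt (by simp)
  have h2 := (contMDiffAt_param1 hψ (q := coord1 ψ w)
    (ψ.map_source hw)).mdifferentiableAt (by simp)
  have h := mfderiv_comp w h2 h1
  have ho : IsOpen {w : TangentBundle (𝓡 m) M | w.1 ∈ ψ.source} :=
    ψ.open_source.preimage (FiberBundle.continuous_proj (Coord m) (TangentSpace (𝓡 m)))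
  have h3 : mfderiv (𝓡 m).tangent (𝓡 m).tangent (param1 ψ ∘ coord1 ψ) w
      = mfderiv (𝓡 m).tangent (𝓡 m).tangent id w := by
    apply Filter.EventuallyEq.mfderiv_eq
    filter_upwards [ho.mem_nhds hw] with z hz using param1_coord1 hψ hz
  rw [h3, mfderiv_id] at h
  intro v
  exact ⟨mfderiv (𝓡 m).tangent 𝓘(ℝ, Coord m × Coord m) (coord1 ψ) w v,
    (DFunLike.congr_fun h v).symm⟩

end Charts

/-! ### Products with the time axis -/

section TimeProduct

variable {E H F : Type*} [NormedAddCommGroup E] [NormedSpace ℝ E] [TopologicalSpace H]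
  [NormedAddCommGroup F] [NormedSpace ℝ F]
  {I : ModelWithCorners ℝ E H} {N : Type*} [TopologicalSpace N] [ChartedSpace H N]

/-- The map `id × f` on `ℝ × F`. -/
def withTime (f : F → N) (z : ℝ × F) : ℝ × N := (z.1, f z.2)

theorem contMDiffAt_withTime {f : F → N} {z : ℝ × F} (hf : ContMDiffAt 𝓘(ℝ, F) I ∞ f z.2) :
    ContMDiffAt 𝓘(ℝ, ℝ × F) (𝓘(ℝ, ℝ).prod I) ∞ (withTime f) z := by
  have h1 : ContMDiffAt 𝓘(ℝ, ℝ × F) 𝓘(ℝ, ℝ) ∞ (fun z : ℝ × F => z.1) z :=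
    contDiff_fst.contMDiff.contMDiffAt
  have h2 : ContMDiffAt 𝓘(ℝ, ℝ × F) 𝓘(ℝ, F) ∞ (fun z : ℝ × F => z.2) z :=
    contDiff_snd.contMDiff.contMDiffAt
  exact h1.prodMk (hf.comp z h2)

theorem mderiv_withTime {f : F → N} {z : ℝ × F} (hf : MDifferentiableAt 𝓘(ℝ, F) I f z.2)
    (ξ : ℝ × F) : mderiv (𝓘(ℝ, ℝ).prod I) (withTime f) z ξ = (ξ.1, mderiv I f z.2 ξ.2) := by
  have h1 : MDifferentiableAt 𝓘(ℝ, ℝ × F) 𝓘(ℝ, ℝ) (fun z : ℝ × F => z.1) z :=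
    differentiableAt_fst.mdifferentiableAt
  have h2 : DifferentiableAt ℝ (fun z : ℝ × F => z.2) z := differentiableAt_snd
  have h3 : MDifferentiableAt 𝓘(ℝ, ℝ × F) I (f ∘ fun z : ℝ × F => z.2) z :=
    hf.comp z h2.mdifferentiableAt
  have h4 := mfderiv_prodMk h1 h3
  have h5 := mderiv_comp (I := I) (f := f) h2 hf
  have h6 : mderiv 𝓘(ℝ, ℝ) (fun z : ℝ × F => z.1) z = ContinuousLinearMap.fst ℝ ℝ F := by
    unfold mderiv
    rw [mfderiv_eq_fderiv]
    exact fderiv_fst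
  have h7 : mderiv (𝓘(ℝ, ℝ).prod I) (withTime f) z
    = (mderiv 𝓘(ℝ, ℝ) (fun z : ℝ × F => z.1) z).prod
      (mderiv I (f ∘ fun z : ℝ × F => z.2) z) := h4
  rw [h7, h6, h5, fderiv_snd]
  rfl

end TimeProduct

/-! ### Velocities of curves and the charts of `T²M` -/

section SecondOrder

variable {m : ℕ} {M : Type*} [TopologicalSpace M] [ChartedSpace (Coord m) M]
  [IsManifold (𝓡 m) ∞ M]
  {ψ : OpenPartialHomeomorph M (Coord m)} (hψ : ψ ∈ charts m M)
include hψ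

/-- The velocity of a curve in the coordinates of a chart. -/
theorem velocity_eventuallyEq (γ : SmoothCurve m M) (hγ : γ.1 0 ∈ ψ.source) :
    velocity γ =ᶠ[nhds 0] fun s => param1 ψ ((ψ ∘ γ.1) s, deriv (ψ ∘ γ.1) s) := by
  have h1 : ∀ᶠ s in nhds (0 : ℝ), γ.1 s ∈ ψ.source :=
    γ.2.continuousAt.eventually (ψ.open_source.mem_nhds hγ)
  have h2 := eventually_mdifferentiableAt γ.2
  filter_upwards [h1.eventually_nhds, h2] with s hs hd
  have hs0 := hs.self_of_nhds
  have hc : DifferentiableAt ℝ (ψ ∘ γ.1) s := by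
    rw [← mdifferentiableAt_iff_differentiableAt]
    exact (mdifferentiableAt_chart hψ hs0).comp s hd
  refine tangent_ext (ψ.left_inv hs0).symm ?_
  have h3 : mderiv (𝓡 m) γ.1 s = mderiv (𝓡 m) (ψ.symm ∘ (ψ ∘ γ.1)) s := by
    apply mderiv_congr
    filter_upwards [hs] with r hr using (ψ.left_inv hr).symm
  rw [mderiv_comp hc (mdifferentiableAt_chart_symm hψ (ψ.map_source hs0))] at h3
  exact DFunLike.congr_fun h3 (1 : ℝ)

omit [IsManifold (𝓡 m) ∞ M] in
/-- The derivative of the coordinates of the velocity of a curve. -/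
theorem hasDerivAt_coord_velocity (γ : SmoothCurve m M) (hγ : γ.1 0 ∈ ψ.source) :
    HasDerivAt (fun s => (((ψ ∘ γ.1) s, deriv (ψ ∘ γ.1) s) : Coord m × Coord m))
      ((jetCoord ψ γ).2.1, (jetCoord ψ γ).2.2) 0 := by
  have hc2 := (curve_contDiffAt hψ γ hγ).of_le two_le_smooth
  have hd : DifferentiableAt ℝ (deriv (ψ ∘ γ.1)) 0 := by
    have : ContDiffAt ℝ 1 (fderiv ℝ (ψ ∘ γ.1)) 0 := hc2.fderiv_right (by norm_num)
    exact ((this.clm_apply contDiffAt_const).differentiableAt (by simp) :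
      DifferentiableAt ℝ (fun t => fderiv ℝ (ψ ∘ γ.1) t 1) 0)
  exact (hc2.differentiableAt (by simp)).hasDerivAt.prodMk hd.hasDerivAt

/-- The tangent vector of the prolongation of a section in coordinates. -/
theorem mderiv_velocity (γ : SmoothCurve m M) (hγ : γ.1 0 ∈ ψ.source) (t : ℝ) :
    mderiv (𝓘(ℝ, ℝ).prod (𝓡 m).tangent)
      (fun s : ℝ => ((s, velocity γ (s - t)) : ℝ × TangentBundle (𝓡 m) M)) t 1
      = mderiv (𝓘(ℝ, ℝ).prod (𝓡 m).tangent) (withTime (param1 ψ))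
        (t, (jetCoord ψ γ).1, (jetCoord ψ γ).2.1)
        (1, (jetCoord ψ γ).2.1, (jetCoord ψ γ).2.2) := by
  set c : ℝ → Coord m × Coord m := fun s => ((ψ ∘ γ.1) s, deriv (ψ ∘ γ.1) s)
  have h0 : Filter.Tendsto (fun s : ℝ => s - t) (nhds t) (nhds 0) := by
    have : ContinuousAt (fun s : ℝ => s - t) t := by fun_prop
    simpa [ContinuousAt] using this
  have h1 : (fun s : ℝ => ((s, velocity γ (s - t)) : ℝ × TangentBundle (𝓡 m) M))
      =ᶠ[nhds t] withTime (param1 ψ) ∘ fun s => (s, c (s - t)) := by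
    filter_upwards [h0.eventually (velocity_eventuallyEq hψ γ hγ)] with s hs
    exact congrArg (Prod.mk s) hs
  have h2 : HasDerivAt (fun s => c (s - t)) ((jetCoord ψ γ).2.1, (jetCoord ψ γ).2.2) t := by
    have := hasDerivAt_coord_velocity hψ γ hγ
    exact HasDerivAt.comp_sub_const (f := c) t t (by rwa [sub_self])
  have h3 : HasDerivAt (fun s => (s, c (s - t)))
      ((1 : ℝ), ((jetCoord ψ γ).2.1, (jetCoord ψ γ).2.2)) t := (hasDerivAt_id t).prodMk h2
  have e : ((t, c (t - t)) : ℝ × Coord m × Coord m)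
      = (t, (jetCoord ψ γ).1, (jetCoord ψ γ).2.1) := by
    rw [sub_self]; rfl
  rw [mderiv_congr h1, mderiv_comp h3.differentiableAt]
  · simp only [e, ContinuousLinearMap.comp_apply]
    congr 1
    exact h3.hasFDerivAt.fderiv ▸ by simp
  · rw [e]
    exact (contMDiffAt_withTime (contMDiffAt_param1 hψ (ψ.map_source hγ))).mdifferentiableAt
      (by simp)

/-- The chart `ψ²` as a homeomorphism between open sets. -/
theorem exists_chart2_openPartialHomeomorph :
    ∃ e ∈ IsManifold.maximalAtlas 𝓘(ℝ, Coord m × Coord m × Coord m) ∞ (T2 m M),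
      e.toPartialEquiv = chart2 ψ hψ := by
  refine ⟨(T2.core m M).openPartialHomeomorph (chart2 ψ hψ) ⟨ψ, hψ, rfl⟩,
    IsManifold.subset_maximalAtlas ?_, rfl⟩
  simp only [atlas, ChartedSpace.atlas, Set.mem_iUnion, Set.mem_singleton_iff]
  exact ⟨_, ⟨ψ, hψ, rfl⟩, rfl⟩

theorem contMDiffAt_chart2 {j : T2 m M} (hj : j.curve.1 0 ∈ ψ.source) :
    ContMDiffAt 𝓘(ℝ, Coord m × Coord m × Coord m) 𝓘(ℝ, Coord m × Coord m × Coord m) ∞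
      (chart2 ψ hψ) j := by
  obtain ⟨e, he, h⟩ := exists_chart2_openPartialHomeomorph hψ
  rw [← h]
  refine contMDiffAt_of_mem_maximalAtlas he ?_
  rw [h]
  exact hj

theorem contMDiffAt_chart2_symm {q : Coord m × Coord m × Coord m} (hq : q.1 ∈ ψ.target) :
    ContMDiffAt 𝓘(ℝ, Coord m × Coord m × Coord m) 𝓘(ℝ, Coord m × Coord m × Coord m) ∞
      (chart2 ψ hψ).symm q := by
  obtain ⟨e, he, h⟩ := exists_chart2_openPartialHomeomorph hψ
  rw [← h]
  refine contMDiffAt_symm_of_mem_maximalAtlas he ?_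
  rw [h]
  exact ⟨hq, trivial⟩

theorem isOpen_chart2_source : IsOpen {j : T2 m M | j.curve.1 0 ∈ ψ.source} := by
  obtain ⟨e, he, h⟩ := exists_chart2_openPartialHomeomorph hψ
  have := e.open_source
  rwa [h] at this

end SecondOrder

/-! ### The 1-contact component in coordinates -/

section Contact

variable {m : ℕ} {M : Type*} [TopologicalSpace M] [ChartedSpace (Coord m) M]
  [IsManifold (𝓡 m) ∞ M]
  {ψ : OpenPartialHomeomorph M (Coord m)} (hψ : ψ ∈ charts m M)

variable (m) in
/-- The projection `(t, x, x', x'') ↦ (t, x, x')`. -/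
def forgetAcc : (ℝ × Coord m × Coord m × Coord m) →L[ℝ] (ℝ × Coord m × Coord m) :=
  (ContinuousLinearMap.id ℝ ℝ).prodMap ((ContinuousLinearMap.id ℝ (Coord m)).prodMap
    (ContinuousLinearMap.fst ℝ (Coord m) (Coord m)))

@[simp] theorem forgetAcc_apply (p : ℝ × Coord m × Coord m × Coord m) :
    forgetAcc m p = (p.1, p.2.1, p.2.2.1) := rfl

include hψ

theorem proj21_eq {P : ℝ × T2 m M} (hP : P.2.curve.1 0 ∈ ψ.source) :
    proj21 P = withTime (param1 ψ) (forgetAcc m (P.1, chart2 ψ hψ P.2)) :=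
  congrArg (Prod.mk P.1) (velocity_eventuallyEq hψ P.2.curve hP).self_of_nhds

theorem mdifferentiableAt_proj21 {P : ℝ × T2 m M} (hP : P.2.curve.1 0 ∈ ψ.source) :
    MDifferentiableAt (𝓘(ℝ, ℝ).prod 𝓘(ℝ, Coord m × Coord m × Coord m))
      (𝓘(ℝ, ℝ).prod (𝓡 m).tangent) proj21 P := by
  have h1 : ContMDiffAt (𝓘(ℝ, ℝ).prod 𝓘(ℝ, Coord m × Coord m × Coord m))
      𝓘(ℝ, ℝ × Coord m × Coord m × Coord m) ∞
      (fun P : ℝ × T2 m M => (P.1, chart2 ψ hψ P.2)) P :=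
    contMDiffAt_fst.prodMk_space
      ((contMDiffAt_chart2 hψ hP).comp P contMDiffAt_snd)
  have h2 := (forgetAcc m).contDiff (n := ∞) |>.contMDiff.contMDiffAt.comp P h1
  have h3 := (contMDiffAt_withTime (z := forgetAcc m (P.1, chart2 ψ hψ P.2))
    (contMDiffAt_param1 hψ (ψ.map_source hP))).comp P h2
  have ho : IsOpen {P : ℝ × T2 m M | P.2.curve.1 0 ∈ ψ.source} :=
    (isOpen_chart2_source hψ).preimage continuous_snd
  refine (h3.mdifferentiableAt (by simp)).congr_of_eventuallyEq ?_
  filter_upwards [ho.mem_nhds hP] with z hz using proj21_eq hψ hz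

theorem contMDiffAt_param2 {p : ℝ × Coord m × Coord m × Coord m} (hp : p.2.1 ∈ ψ.target) :
    ContMDiffAt 𝓘(ℝ, ℝ × Coord m × Coord m × Coord m)
      (𝓘(ℝ, ℝ).prod 𝓘(ℝ, Coord m × Coord m × Coord m)) ∞ (param2 ψ hψ) p :=
  contMDiffAt_withTime (contMDiffAt_chart2_symm hψ hp)

omit [IsManifold (𝓡 m) ∞ M] in
theorem param2_curve_zero {p : ℝ × Coord m × Coord m × Coord m} (hp : p.2.1 ∈ ψ.target) :
    (param2 ψ hψ p).2.curve.1 0 ∈ ψ.source :=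
  (chart2 ψ hψ).map_target (x := p.2) ⟨hp, trivial⟩

omit [IsManifold (𝓡 m) ∞ M] in
theorem jetCoord_param2 {p : ℝ × Coord m × Coord m × Coord m} (hp : p.2.1 ∈ ψ.target) :
    jetCoord ψ (param2 ψ hψ p).2.curve = p.2 :=
  (chart2 ψ hψ).right_inv (x := p.2) ⟨hp, trivial⟩

theorem proj21_param2 {p : ℝ × Coord m × Coord m × Coord m} (hp : p.2.1 ∈ ψ.target) :
    proj21 (param2 ψ hψ p) = withTime (param1 ψ) (forgetAcc m p) := by
  rw [proj21_eq hψ (param2_curve_zero hψ hp)]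
  congr 2
  exact congrArg (Prod.mk p.1) (jetCoord_param2 hψ hp)

/-- The tangent map of the inverse of the chart `id × ψ²`. -/
def tparam2 (p : ℝ × Coord m × Coord m × Coord m) :
    (ℝ × Coord m × Coord m × Coord m) →L[ℝ] (ℝ × Coord m × Coord m × Coord m) :=
  mderiv (𝓘(ℝ, ℝ).prod 𝓘(ℝ, Coord m × Coord m × Coord m)) (param2 ψ hψ) p

/-- `π^{2,1}` in coordinates. -/
theorem tproj21_param2 {p : ℝ × Coord m × Coord m × Coord m} (hp : p.2.1 ∈ ψ.target)
    (ξ : ℝ × Coord m × Coord m × Coord m) :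
    (tproj21 (param2 ψ hψ p) (tparam2 hψ p ξ) : ℝ × Coord m × Coord m)
      = mderiv (𝓘(ℝ, ℝ).prod (𝓡 m).tangent) (withTime (param1 ψ)) (forgetAcc m p)
        (forgetAcc m ξ) := by
  have h1 := mfderiv_comp p (mdifferentiableAt_proj21 hψ (param2_curve_zero hψ hp))
    ((contMDiffAt_param2 hψ hp).mdifferentiableAt (by simp))
  have ho : IsOpen {p : ℝ × Coord m × Coord m × Coord m | p.2.1 ∈ ψ.target} :=
    ψ.open_target.preimage
      (by fun_prop : Continuous fun p : ℝ × Coord m × Coord m × Coord m => p.2.1)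
  have h2 : mderiv (𝓘(ℝ, ℝ).prod (𝓡 m).tangent) (proj21 ∘ param2 ψ hψ) p
      = mderiv (𝓘(ℝ, ℝ).prod (𝓡 m).tangent) (withTime (param1 ψ) ∘ forgetAcc m) p := by
    apply mderiv_congr
    filter_upwards [ho.mem_nhds hp] with z hz using proj21_param2 hψ hz
  rw [mderiv_comp (forgetAcc m).differentiableAt
    ((contMDiffAt_withTime (contMDiffAt_param1 hψ hp)).mdifferentiableAt (by simp)),
    ContinuousLinearMap.fderiv] at h2
  exact (DFunLike.congr_fun h1 ξ).symm.trans (DFunLike.congr_fun h2 ξ)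

/-- The horizontal component of a tangent vector in coordinates. -/
theorem horiz_param2 {p : ℝ × Coord m × Coord m × Coord m} (hp : p.2.1 ∈ ψ.target)
    (ξ : ℝ × Coord m × Coord m × Coord m) :
    (horiz (param2 ψ hψ p) (tparam2 hψ p ξ) : ℝ × Coord m × Coord m)
      = mderiv (𝓘(ℝ, ℝ).prod (𝓡 m).tangent) (withTime (param1 ψ)) (forgetAcc m p)
        (ξ.1 • (1, p.2.2.1, p.2.2.2)) := by
  have h1 := mderiv_velocity hψ (param2 ψ hψ p).2.curve (param2_curve_zero hψ hp) p.1
  rw [jetCoord_param2 hψ hp] at h1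
  have h2 : tparam2 hψ p ξ = (ξ.1, mderiv 𝓘(ℝ, Coord m × Coord m × Coord m) (chart2 ψ hψ).symm p.2 ξ.2) :=
    mderiv_withTime ((contMDiffAt_chart2_symm hψ hp).mdifferentiableAt (by simp)) ξ
  have h3 : (mfderiv (𝓘(ℝ, ℝ).prod 𝓘(ℝ, Coord m × Coord m × Coord m)) 𝓘(ℝ, ℝ) Prod.fst
      (param2 ψ hψ p) : _ →L[ℝ] ℝ) (tparam2 hψ p ξ) = ξ.1 := by
    rw [mfderiv_fst, h2]
    rfl
  rw [map_smul]
  rw [forgetAcc_apply, ← h1, ← map_smul, smul_eq_mul, mul_one]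
  exact congrArg (mderiv (𝓘(ℝ, ℝ).prod (𝓡 m).tangent) (fun s : ℝ =>
    ((s, velocity (param2 ψ hψ p).2.curve (s - p.1)) : ℝ × TangentBundle (𝓡 m) M)) p.1) h3

/-- The coordinate expression of the `1`-contact component. -/
theorem coordExpr_oneContact (α : FormRTM m M 2) {p : ℝ × Coord m × Coord m × Coord m}
    (hp : p.2.1 ∈ ψ.target) (ξ η : ℝ × Coord m × Coord m × Coord m) :
    pairing (DForm.coordExpr (param2 ψ hψ) (oneContact α) p) ξ η
      = pairing (DForm.coordExpr (withTime (param1 ψ)) α (forgetAcc m p)) (forgetAcc m ξ)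
          (forgetAcc m η)
        - pairing (DForm.coordExpr (withTime (param1 ψ)) α (forgetAcc m p))
          (forgetAcc m ξ - ξ.1 • (1, p.2.2.1, p.2.2.2))
          (forgetAcc m η - η.1 • (1, p.2.2.1, p.2.2.2)) := by
  let L : (ℝ × Coord m × Coord m × Coord m) →L[ℝ] (ℝ × Coord m × Coord m) :=
    tproj21 (param2 ψ hψ p)
  let K : (ℝ × Coord m × Coord m × Coord m) →L[ℝ] (ℝ × Coord m × Coord m) :=
    horiz (param2 ψ hψ p)
  let W := mderiv (𝓘(ℝ, ℝ).prod (𝓡 m).tangent) (withTime (param1 ψ)) (forgetAcc m p)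
  have h0 : DForm.coordExpr (param2 ψ hψ) (oneContact α) p
      = (formAt α (proj21 (param2 ψ hψ p))).compContinuousLinearMap (L.comp (tparam2 hψ p))
        - (formAt α (proj21 (param2 ψ hψ p))).compContinuousLinearMap
          ((L - K).comp (tparam2 hψ p)) := rfl
  have hL : ∀ ξ, L.comp (tparam2 hψ p) ξ = W (forgetAcc m ξ) := tproj21_param2 hψ hp
  have hK : ∀ ξ, (L - K).comp (tparam2 hψ p) ξ
      = W (forgetAcc m ξ - ξ.1 • (1, p.2.2.1, p.2.2.2)) := fun ξ => by
    rw [map_sub, ← horiz_param2 hψ hp, ← tproj21_param2 hψ hp]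
    rfl
  rw [h0, pairing_sub, pairing_comp, pairing_comp, coordExpr_eq, pairing_comp, pairing_comp, hL, hL, hK,
    hK, proj21_param2 hψ hp]

/-- The defining property of the Lepage equivalent in coordinates. -/
theorem isLocalLepage {ε : FormRT2M m M 2} (hε : IsSourceForm ε) {α : FormRTM m M 2}
    (hα : IsLepageEquivalent ε α) :
    IsLocalLepage ψ.target
      (fun q => ∑ i, srcCoeff ε ψ hψ i q • (EuclideanSpace.proj i : Coord m →L[ℝ] ℝ).toLinearMap)
      (DForm.coordExpr (withTime (param1 ψ)) α) := by
  refine ⟨ψ.open_target, fun p hp => ?_, fun p hp => ?_, fun p hp X Y a => ?_⟩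
  · exact (contDiffAt_coordExpr hα.smooth
      (contMDiffAt_withTime (contMDiffAt_param1 hψ hp))).differentiableAt (by simp)
  · exact extDeriv_coordExpr hα.smooth hα.closed
      (contMDiffAt_withTime (contMDiffAt_param1 hψ hp))
  -- The second argument is a lift of `D` at acceleration `a`. Its contact part is zero, so the
  -- 2-contact term disappears, and `ωⁱ ∧ dt` takes the value `Xⁱ` on this pair.
  · have h := coordExpr_oneContact hψ α (p := (p.1, p.2.1, p.2.2, a)) hp (0, X, Y, 0)
      (1, p.2.2, a, 0)
    rw [hα.oneContact_eq, (hε ψ hψ).2 _ hp] at h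
    have e1 : forgetAcc m ((0 : ℝ), X, Y, (0 : Coord m)) = (0, X, Y) := rfl
    have e2 : forgetAcc m ((1 : ℝ), p.2.2, a, (0 : Coord m)) = (1, p.2.2, a) := rfl
    have e3 : forgetAcc m (p.1, p.2.1, p.2.2, a) = p := rfl
    simp only [e1, e2, e3, one_smul, sub_self, map_zero, sub_zero] at h
    rw [← h]
    simp [pairing_sum, pairing_smul, pairing_wedge, contact2, dt2]

end Contact

/-! ### Splitting a 2-form on `ℝ × E` into its `dt` part and its spatial part -/

section Algebra

variable {E : Type*} [NormedAddCommGroup E] [NormedSpace ℝ E]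

/-- The linear form `ξ ↦ a(ξ, ∂/∂t)` on `E` for a `2`-form `a` on `ℝ × E`. -/
def timeContraction (a : (ℝ × E) [⋀^Fin 2]→L[ℝ] ℝ) : E →L[ℝ] ℝ :=
  -((ContinuousAlternatingMap.ofSubsingleton ℝ (ℝ × E) ℝ (0 : Fin 1)).symm
    (a.curryLeft (1, 0))).comp (ContinuousLinearMap.inr ℝ ℝ E)

theorem timeContraction_apply (a : (ℝ × E) [⋀^Fin 2]→L[ℝ] ℝ) (ξ : E) :
    timeContraction a ξ = pairing a (0, ξ) (1, 0) := by
  rw [pairing_swap]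
  refine congrArg (fun v => -(a v)) ?_
  ext i <;> fin_cases i <;> rfl

/-- The restriction to `E` of a `2`-form on `ℝ × E`. -/
def spaceRestriction (a : (ℝ × E) [⋀^Fin 2]→L[ℝ] ℝ) : E [⋀^Fin 2]→L[ℝ] ℝ :=
  a.compContinuousLinearMap (ContinuousLinearMap.inr ℝ ℝ E)

theorem pairing_spaceRestriction (a : (ℝ × E) [⋀^Fin 2]→L[ℝ] ℝ) (ξ η : E) :
    pairing (spaceRestriction a) ξ η = pairing a (0, ξ) (0, η) := by
  rw [spaceRestriction, pairing_comp]
  rfl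

/-- The form `a₀ ∧ dt + a'` on `ℝ × E`. -/
def timeSum (a₀ : E →L[ℝ] ℝ) (a' : E [⋀^Fin 2]→L[ℝ] ℝ) : (ℝ × E) [⋀^Fin 2]→L[ℝ] ℝ :=
  wedge (a₀.comp (ContinuousLinearMap.snd ℝ ℝ E)) (ContinuousLinearMap.fst ℝ ℝ E)
    + a'.compContinuousLinearMap (ContinuousLinearMap.snd ℝ ℝ E)

theorem pairing_timeSum (a₀ : E →L[ℝ] ℝ) (a' : E [⋀^Fin 2]→L[ℝ] ℝ) (u v : ℝ × E) :
    pairing (timeSum a₀ a') u v = a₀ u.2 * v.1 - a₀ v.2 * u.1 + pairing a' u.2 v.2 := by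
  rw [timeSum, pairing_add, pairing_wedge, pairing_comp]
  rfl

theorem pairing_self (a : (ℝ × E) [⋀^Fin 2]→L[ℝ] ℝ) (u : ℝ × E) : pairing a u u = 0 := by
  have := pairing_swap a u u
  linarith

theorem timeSum_eq (a : (ℝ × E) [⋀^Fin 2]→L[ℝ] ℝ) :
    timeSum (timeContraction a) (spaceRestriction a) = a := by
  refine form_two_ext fun u v => ?_
  have e : ∀ u : ℝ × E, u = u.1 • (1, 0) + (0, u.2) := fun u => by ext <;> simp
  rw [pairing_timeSum, timeContraction_apply, timeContraction_apply, pairing_spaceRestriction]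
  conv_rhs => rw [e u, e v]
  simp only [map_add, map_smul, LinearMap.add_apply, LinearMap.smul_apply, smul_eq_mul,
    pairing_self]
  rw [pairing_swap a (1, 0) (0, v.2)]
  ring

theorem timeContraction_timeSum (a₀ : E →L[ℝ] ℝ) (a' : E [⋀^Fin 2]→L[ℝ] ℝ) :
    timeContraction (timeSum a₀ a') = a₀ := by
  ext ξ
  rw [timeContraction_apply, pairing_timeSum]
  simp

theorem spaceRestriction_timeSum (a₀ : E →L[ℝ] ℝ) (a' : E [⋀^Fin 2]→L[ℝ] ℝ) :
    spaceRestriction (timeSum a₀ a') = a' := by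
  refine form_two_ext fun u v => ?_
  rw [pairing_spaceRestriction, pairing_timeSum]
  simp

/-- A linear form considered as an alternating `1`-form. -/
def oneForm (a : E →L[ℝ] ℝ) : E [⋀^Fin 1]→L[ℝ] ℝ :=
  ContinuousAlternatingMap.ofSubsingleton ℝ E ℝ (0 : Fin 1) a

theorem oneForm_apply (a : E →L[ℝ] ℝ) (v : Fin 1 → E) : oneForm a v = a (v 0) := rfl

theorem linForm_oneForm (a : E →L[ℝ] ℝ) : linForm (oneForm a) = a :=
  Equiv.symm_apply_apply _ a

theorem oneForm_linForm (a : E [⋀^Fin 1]→L[ℝ] ℝ) : oneForm (linForm a) = a :=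
  Equiv.apply_symm_apply _ a

theorem comp_injective_of_surjective {P Q : Type*} [NormedAddCommGroup P] [NormedSpace ℝ P]
    [NormedAddCommGroup Q] [NormedSpace ℝ Q] {a b : Q [⋀^Fin 2]→L[ℝ] ℝ} {L : P →L[ℝ] Q}
    (hL : Function.Surjective L)
    (h : a.compContinuousLinearMap L = b.compContinuousLinearMap L) : a = b := by
  refine form_two_ext fun u v => ?_
  obtain ⟨u, rfl⟩ := hL u
  obtain ⟨v, rfl⟩ := hL v
  rw [← pairing_comp, ← pairing_comp, h]

end Algebra

/-! ### Independence of time -/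

namespace IsLocalLepage

variable {E : Type*} [NormedAddCommGroup E] [NormedSpace ℝ E]
  {U : Set E} {e : E × E × E → E →ₗ[ℝ] ℝ}
  {β : ℝ × E × E → (ℝ × E × E) [⋀^Fin 2]→L[ℝ] ℝ} (h : IsLocalLepage U e β)
include h

theorem pairing_space {p : ℝ × E × E} (hp : p.2.1 ∈ U) (X Y X' Y' : E) :
    pairing (β p) (0, X, Y) (0, X', Y') = pairing (β p) (0, X, 0) (0, X', 0)
      + pairing (β p) (0, X, 0) (0, 0, Y') - pairing (β p) (0, X', 0) (0, 0, Y) := by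
  have e : ∀ X Y : E, ((0, X, Y) : ℝ × E × E) = (0, X, 0) + (0, 0, Y) := fun X Y => by simp
  rw [e X Y, e X' Y']
  simp only [map_add, LinearMap.add_apply]
  rw [h.pairing_vel_vel hp, pairing_swap _ (0, 0, Y) (0, X', 0)]
  ring

/-- `β` does not depend on time. -/
theorem time_indep {q : E × E} (hq : q.1 ∈ U) (s t : ℝ) : β (s, q) = β (t, q) := by
  have hs : ((s, q) : ℝ × E × E).2.1 ∈ U := hq
  have ht : ((t, q) : ℝ × E × E).2.1 ∈ U := hq
  -- Both spatial components are given by formulas in `e` and its derivatives at `q`, in which time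
  -- does not occur.
  have h1 : spaceRestriction (β (s, q)) = spaceRestriction (β (t, q)) := by
    refine form_two_ext fun u v => ?_
    have hF := h.two_mul_pairing_pos_pos hs u.1 v.1
    have hF' := h.two_mul_pairing_pos_pos ht u.1 v.1
    rw [pairing_spaceRestriction, pairing_spaceRestriction, h.pairing_space hs,
      h.pairing_space ht, h.pairing_acc hs, h.pairing_acc hs, h.pairing_acc ht, h.pairing_acc ht]
    linarith
  have h2 : timeContraction (β (s, q)) = timeContraction (β (t, q)) := by
    refine ContinuousLinearMap.ext fun u => ?_
    -- `velField` at `(s, q)` is the spatial vector `(q.2, 0)`, so `pairing_time` reduces the time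
    -- component to the spatial part already compared.
    have hb := congrArg (fun a : (E × E) [⋀^Fin 2]→L[ℝ] ℝ => pairing a u (q.2, 0)) h1
    simp only [pairing_spaceRestriction] at hb
    rw [timeContraction_apply, timeContraction_apply]
    refine (h.pairing_time hs u.1 u.2).trans (Eq.trans ?_ (h.pairing_time ht u.1 u.2).symm)
    exact congrArg (_ - ·) hb
  rw [← timeSum_eq (β (s, q)), h1, h2, timeSum_eq]

end IsLocalLepage

/-! ### The global forms on `TM`: existence, closedness and uniqueness -/

section Global

variable {m : ℕ} {M : Type*} [TopologicalSpace M] [ChartedSpace (Coord m) M]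
  [IsManifold (𝓡 m) ∞ M]

/-- `i_{-∂/∂t} α` at `t = 0`. -/
def timePart (α : FormRTM m M 2) : FormTM m M 1 :=
  fun w => oneForm (timeContraction (formAt α (0, w)))

/-- The restriction of `α` to `t = 0`. -/
def spacePart (α : FormRTM m M 2) : FormTM m M 2 :=
  fun w => spaceRestriction (formAt α (0, w))

/-- The Lepage equivalent does not depend on time. -/
theorem formAt_time_indep {ε : FormRT2M m M 2} (hε : IsSourceForm ε) {α : FormRTM m M 2}
    (hα : IsLepageEquivalent ε α) (w : TangentBundle (𝓡 m) M) (s t : ℝ) :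
    formAt α (s, w) = formAt α (t, w) := by
  have hψ : chartAt (Coord m) w.1 ∈ charts m M := IsManifold.chart_mem_maximalAtlas _
  set ψ := chartAt (Coord m) w.1
  have hw : w.1 ∈ ψ.source := mem_chart_source _ _
  have hq : (coord1 ψ w).1 ∈ ψ.target := ψ.map_source hw
  have h := (isLocalLepage hψ hε hα).time_indep hq s t
  -- The tangent map of `id × param1 ψ` is block diagonal and the same at all times. As it is
  -- surjective, equality of the coordinate expressions passes to `α` itself.
  have hm : ∀ t : ℝ, mderiv (𝓘(ℝ, ℝ).prod (𝓡 m).tangent) (withTime (param1 ψ)) (t, coord1 ψ w)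
      = (ContinuousLinearMap.id ℝ ℝ).prodMap
        (mderiv (𝓡 m).tangent (param1 ψ) (coord1 ψ w)) := fun t => by
    refine ContinuousLinearMap.ext fun ξ => ?_
    exact mderiv_withTime (z := (t, coord1 ψ w))
      ((contMDiffAt_param1 hψ hq).mdifferentiableAt (by simp)) ξ
  have hp : ∀ t : ℝ, withTime (param1 ψ) (t, coord1 ψ w) = (t, w) := fun t =>
    congrArg (Prod.mk t) (param1_coord1 hψ hw)
  rw [coordExpr_eq, coordExpr_eq, hm, hm, hp, hp] at h
  refine comp_injective_of_surjective ?_ h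
  exact Function.surjective_id.prodMap (mderiv_param1_surjective hψ hw)

variable {F : Type*} [NormedAddCommGroup F] [NormedSpace ℝ F]

theorem coordExpr_timePart (α : FormRTM m M 2) {f : F → TangentBundle (𝓡 m) M} {y : F}
    (hf : MDifferentiableAt 𝓘(ℝ, F) (𝓡 m).tangent f y) :
    DForm.coordExpr f (timePart α) y
      = oneForm (timeContraction (DForm.coordExpr (withTime f) α (0, y))) := by
  ext v
  rw [oneForm_apply, timeContraction_apply, coordExpr_eq, coordExpr_eq, pairing_comp,
    mderiv_withTime hf, mderiv_withTime hf]
  simp only [map_zero]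
  exact timeContraction_apply _ _

theorem coordExpr_spacePart (α : FormRTM m M 2) {f : F → TangentBundle (𝓡 m) M} {y : F}
    (hf : MDifferentiableAt 𝓘(ℝ, F) (𝓡 m).tangent f y) :
    DForm.coordExpr f (spacePart α) y
      = spaceRestriction (DForm.coordExpr (withTime f) α (0, y)) := by
  refine form_two_ext fun u v => ?_
  rw [pairing_spaceRestriction, coordExpr_eq, coordExpr_eq, pairing_comp, pairing_comp,
    mderiv_withTime hf, mderiv_withTime hf]
  exact pairing_spaceRestriction _ _ _

variable {ε : FormRT2M m M 2} (hε : IsSourceForm ε) {α : FormRTM m M 2}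
  (hα : IsLepageEquivalent ε α)

theorem contDiffAt_coordExpr_timePart (hα : DForm.IsSmooth α) [FiniteDimensional ℝ F]
    {f : F → TangentBundle (𝓡 m) M} {y : F}
    (hf : ContMDiffAt 𝓘(ℝ, F) (𝓡 m).tangent ∞ f y) :
    ContDiffAt ℝ ∞ (DForm.coordExpr f (timePart α)) y ∧
      ContDiffAt ℝ ∞ (DForm.coordExpr f (spacePart α)) y := by
  have h1 : ContDiffAt ℝ ∞ (DForm.coordExpr (withTime f) α) ((0 : ℝ), y) :=
    contDiffAt_coordExpr hα (contMDiffAt_withTime hf)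
  have h2 : ContDiffAt ℝ ∞ (fun z => DForm.coordExpr (withTime f) α ((0 : ℝ), z)) y :=
    h1.comp y (contDiffAt_const.prodMk contDiffAt_id)
  have h3 := eventually_mdifferentiableAt hf
  constructor
  · refine contDiffAt_form fun v => ?_
    have h4 : ContDiffAt ℝ ∞ (fun z => pairing (DForm.coordExpr (withTime f) α ((0 : ℝ), z))
        (0, v 0) (1, 0)) y :=
      (ContinuousAlternatingMap.apply ℝ (ℝ × F) ℝ ![(0, v 0), (1, 0)]).contDiff.contDiffAt.comp
        y h2
    refine h4.congr_of_eventuallyEq ?_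
    filter_upwards [h3] with z hz
    rw [coordExpr_timePart α hz, oneForm_apply, timeContraction_apply]
  · refine (contDiffAt_pullback h2 (contDiffAt_const
      (c := ContinuousLinearMap.inr ℝ ℝ F))).congr_of_eventuallyEq ?_
    filter_upwards [h3] with z hz using coordExpr_spacePart α hz

include hε hα

theorem coordExpr_withTime_indep {f : F → TangentBundle (𝓡 m) M} {y : F}
    (hf : MDifferentiableAt 𝓘(ℝ, F) (𝓡 m).tangent f y) (s t : ℝ) :
    DForm.coordExpr (withTime f) α (s, y) = DForm.coordExpr (withTime f) α (t, y) := by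
  refine form_two_ext fun u v => ?_
  rw [coordExpr_eq, coordExpr_eq, pairing_comp, pairing_comp, mderiv_withTime hf,
    mderiv_withTime hf, mderiv_withTime hf, mderiv_withTime hf]
  exact congrArg (fun a => pairing a (u.1, mderiv (𝓡 m).tangent f y u.2)
    (v.1, mderiv (𝓡 m).tangent f y v.2)) (formAt_time_indep hε hα (f y) s t)

-- The spatial part is the pull-back of `α` along the slice `z ↦ (0, z)`, and the pull-back of a
-- closed form is closed.
omit hε in
theorem extDeriv_coordExpr_spacePart {f : F → TangentBundle (𝓡 m) M} {y : F}
    (hf : ContMDiffAt 𝓘(ℝ, F) (𝓡 m).tangent ∞ f y) [FiniteDimensional ℝ F] :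
    extDeriv (DForm.coordExpr f (spacePart α)) y = 0 := by
  have h0 := contMDiffAt_withTime (z := ((0 : ℝ), y)) hf
  have h1 := contDiffAt_coordExpr hα.smooth h0
  have hi : ∀ z : F, HasFDerivAt (fun z => ((0 : ℝ), z)) (ContinuousLinearMap.inr ℝ ℝ F) z :=
    fun z => hasFDerivAt_prodMk_right 0 z
  have h2 : DForm.coordExpr f (spacePart α) =ᶠ[nhds y] fun z =>
      (DForm.coordExpr (withTime f) α ((0 : ℝ), z)).compContinuousLinearMap
        (fderiv ℝ (fun z : F => ((0 : ℝ), z)) z) := by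
    filter_upwards [eventually_mdifferentiableAt hf] with z hz
    rw [(hi z).fderiv]
    exact coordExpr_spacePart α hz
  have h3 : ContDiffAt ℝ ∞ (fun z : F => ((0 : ℝ), z)) y := contDiffAt_const.prodMk contDiffAt_id
  rw [h2.extDeriv_eq, extDeriv_pullback (f := fun z : F => ((0 : ℝ), z))
    (h1.differentiableAt (by simp)) h3 (by simpa [minSmoothness] using two_le_smooth),
    extDeriv_coordExpr hα.smooth hα.closed h0]
  rfl

/-- Closedness of `α` on `(v₀, v₁, ∂/∂t)` equates the exterior derivative of `timePart α` on `(v₀,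
v₁)`, up to sign, with the time derivative of `α`, which is zero. This is Cartan's formula for
`∂/∂t` written out. -/
theorem extDeriv_coordExpr_timePart {f : F → TangentBundle (𝓡 m) M} {y : F}
    (hf : ContMDiffAt 𝓘(ℝ, F) (𝓡 m).tangent ∞ f y) [FiniteDimensional ℝ F] :
    extDeriv (DForm.coordExpr f (timePart α)) y = 0 := by
  have h0 := contMDiffAt_withTime (z := ((0 : ℝ), y)) hf
  have h1 := (contDiffAt_coordExpr hα.smooth h0).differentiableAt (by simp)
  have h2 := (contDiffAt_coordExpr_timePart hα.smooth hf).1.differentiableAt (by simp)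
  have hf' := eventually_mdifferentiableAt hf
  have hd : ∀ (v : Fin 1 → F) (w : F),
      fderiv ℝ (fun z => DForm.coordExpr f (timePart α) z v) y w
        = pairing (fderiv ℝ (DForm.coordExpr (withTime f) α) ((0 : ℝ), y) (0, w))
          (0, v 0) (1, 0) := fun v w => by
    have h3 : (fun z => DForm.coordExpr f (timePart α) z v) =ᶠ[nhds y]
        (fun p : ℝ × F => pairing (DForm.coordExpr (withTime f) α p) (0, v 0) (1, 0)) ∘
          fun z => ((0 : ℝ), z) := by
      filter_upwards [hf'] with z hz
      rw [coordExpr_timePart α hz, oneForm_apply, timeContraction_apply]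
      rfl
    rw [h3.fderiv_eq, fderiv_comp y (differentiableAt_pairing h1 _ _)
      (hasFDerivAt_prodMk_right (0 : ℝ) y).differentiableAt,
      (hasFDerivAt_prodMk_right (0 : ℝ) y).fderiv, ContinuousLinearMap.comp_apply,
      fderiv_pairing h1]
    rfl
  have ht : ∀ u v : ℝ × F,
      pairing (fderiv ℝ (DForm.coordExpr (withTime f) α) ((0 : ℝ), y) (1, 0)) u v = 0 := by
    intro u v
    rw [← fderiv_pairing h1, ← (differentiableAt_pairing h1 u v).lineDeriv_eq_fderiv, lineDeriv]
    have : (fun t : ℝ => pairing (DForm.coordExpr (withTime f) α (((0 : ℝ), y) + t • (1, 0))) u v)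
        = fun _ => pairing (DForm.coordExpr (withTime f) α ((0 : ℝ), y)) u v := by
      funext t
      have e : (((0 : ℝ), y) + t • (1, 0)) = (t, y) := by simp
      rw [e, coordExpr_withTime_indep hε hα hf'.self_of_nhds t 0]
    rw [this]
    simp
  ext v
  have h4 := (extDeriv_apply h2 v).trans (Fin.sum_univ_two _)
  rw [hd, hd] at h4
  have h5 := pairing_closed h1 (extDeriv_coordExpr hα.smooth hα.closed h0) (0, v 0) (0, v 1)
    (1, 0)
  rw [ht] at h5
  have e0 : (0 : Fin 2).removeNth v 0 = v 1 := rfl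
  have e1 : (1 : Fin 2).removeNth v 0 = v 0 := rfl
  rw [e0, e1] at h4
  refine h4.trans ?_
  simp
  linarith

omit hε hα in
/-- The decomposition condition at a point. -/
theorem decomposition_iff (α₀ : FormTM m M 1) (α' : FormTM m M 2)
    (p : ℝ × TangentBundle (𝓡 m) M) :
    (α p = wedge (linForm (DForm.pullback Prod.snd α₀ p))
        (mfderiv (𝓘(ℝ, ℝ).prod (𝓡 m).tangent) 𝓘(ℝ, ℝ) Prod.fst p)
      + DForm.pullback Prod.snd α' p) ↔
    formAt α p = timeSum (linForm (formAt α₀ p.2)) (formAt α' p.2) := by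
  have h1 : DForm.pullback (I := 𝓘(ℝ, ℝ).prod (𝓡 m).tangent) Prod.snd α₀ p
    = (formAt α₀ p.2).compContinuousLinearMap (ContinuousLinearMap.snd ℝ ℝ _) := by
    unfold DForm.pullback
    rw [mfderiv_snd]
    rfl
  have h2 : DForm.pullback (I := 𝓘(ℝ, ℝ).prod (𝓡 m).tangent) Prod.snd α' p
    = (formAt α' p.2).compContinuousLinearMap (ContinuousLinearMap.snd ℝ ℝ _) := by
    unfold DForm.pullback
    rw [mfderiv_snd]
    rfl
  rw [h1, h2, mfderiv_fst]
  rfl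

theorem isClosedDecomposition_parts :
    IsClosedDecomposition α (timePart α) (spacePart α) where
  smooth_zero := fun e he y hy =>
    (contDiffAt_coordExpr_timePart hα.smooth (contMDiffAt_extend_symm he hy)).1.contDiffWithinAt
  closed_zero := fun e he y hy =>
    extDeriv_coordExpr_timePart hε hα (contMDiffAt_extend_symm he hy)
  smooth_prime := fun e he y hy =>
    (contDiffAt_coordExpr_timePart hα.smooth (contMDiffAt_extend_symm he hy)).2.contDiffWithinAt
  closed_prime := fun e he y hy =>
    extDeriv_coordExpr_spacePart hα (contMDiffAt_extend_symm he hy)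
  eq := fun p => by
    rw [decomposition_iff]
    have h1 : linForm (formAt (timePart α) p.2) = timeContraction (formAt α (0, p.2)) :=
      linForm_oneForm _
    have h2 : formAt (spacePart α) p.2 = spaceRestriction (formAt α (0, p.2)) := rfl
    rw [h1, h2, timeSum_eq]
    exact formAt_time_indep hε hα p.2 p.1 0

-- At a fixed point both summands are recovered from `α`: contraction with `∂/∂t` returns the first
-- and restriction to spatial vectors the second.
omit hε hα in
theorem eq_parts_of_isClosedDecomposition {α₀ : FormTM m M 1} {α' : FormTM m M 2}
    (h : IsClosedDecomposition α α₀ α') : α₀ = timePart α ∧ α' = spacePart α := by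
  have h1 : ∀ w, formAt α (0, w) = timeSum (linForm (formAt α₀ w)) (formAt α' w) := fun w =>
    (decomposition_iff α₀ α' (0, w)).1 (h.eq (0, w))
  constructor
  · funext w
    change formAt α₀ w = oneForm (timeContraction (formAt α (0, w)))
    rw [h1, timeContraction_timeSum, oneForm_linForm]
  · funext w
    change formAt α' w = spaceRestriction (formAt α (0, w))
    rw [h1, spaceRestriction_timeSum]

end Global

/-! ### Coordinate formulas for `α₀` and `α'` -/

section Formulas

variable {m : ℕ} {M : Type*} [TopologicalSpace M] [ChartedSpace (Coord m) M]
  [IsManifold (𝓡 m) ∞ M]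
  {ψ : OpenPartialHomeomorph M (Coord m)} (hψ : ψ ∈ charts m M)
  {ε : FormRT2M m M 2} (hε : IsSourceForm ε) {α : FormRTM m M 2}
  (hα : IsLepageEquivalent ε α) {q : Coord m × Coord m} (hq : q.1 ∈ ψ.target)

theorem dx_apply (i : Fin m) (w : Coord m × Coord m) : dx i w = w.1 i := rfl

theorem dv_apply (i : Fin m) (w : Coord m × Coord m) : dv i w = w.2 i := rfl

theorem sum_bas (X : Coord m) : X = ∑ i, X i • bas i := by
  ext j
  simp [Finset.sum_apply, Pi.single_apply]

theorem curlA_swap (i j : Fin m) : curlA ε ψ hψ i j q = -curlA ε ψ hψ j i q := by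
  simp [curlA]

include hψ hε hα hq

theorem pairing_bas_acc (i : Fin m) (a : Coord m) :
    pairing (DForm.coordExpr (withTime (param1 ψ)) α ((0 : ℝ), q)) (0, bas i, 0) (0, 0, a)
      = srcCoeff ε ψ hψ i (q.1, q.2, a) - coeffA ε ψ hψ i q := by
  rw [(isLocalLepage hψ hε hα).pairing_acc (p := (0, q)) hq]
  simp [coeffA]

theorem coeffB_eq (i j : Fin m) : coeffB ε ψ hψ i j q
    = pairing (DForm.coordExpr (withTime (param1 ψ)) α ((0 : ℝ), q)) (0, bas i, 0)
      (0, 0, bas j) := by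
  have hs : ContDiffAt ℝ ∞ (srcCoeff ε ψ hψ i) (q.1, q.2, 0) :=
    ((hε ψ hψ).1 i).contDiffAt ((ψ.open_target.prod isOpen_univ).mem_nhds ⟨hq, trivial⟩)
  rw [coeffB, ← (hs.differentiableAt (by simp)).lineDeriv_eq_fderiv, lineDeriv]
  -- Along this line `εᵢ` is affine in `t` with slope the `dxⁱ ∧ dx'ʲ` component of `β`, so its
  -- derivative at `0` is that component.
  have : (fun t : ℝ => srcCoeff ε ψ hψ i ((q.1, q.2, 0) + t • (0, 0, bas j)))
      = fun t => coeffA ε ψ hψ i q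
        + t * pairing (DForm.coordExpr (withTime (param1 ψ)) α ((0 : ℝ), q)) (0, bas i, 0)
          (0, 0, bas j) := by
    funext t
    have h := pairing_bas_acc hψ hε hα hq i (t • bas j)
    have e : ((0, 0, t • bas j) : ℝ × Coord m × Coord m) = t • (0, 0, bas j) := by simp
    have e' : ((q.1, q.2, 0) + t • (0, 0, bas j) : Coord m × Coord m × Coord m)
        = (q.1, q.2, t • bas j) := by simp
    rw [e, map_smul, smul_eq_mul] at h
    rw [e', h]
    ring
  rw [this]
  simp

theorem pairing_pos_vel_eq (X Y : Coord m) :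
    pairing (DForm.coordExpr (withTime (param1 ψ)) α ((0 : ℝ), q)) (0, X, 0) (0, 0, Y)
      = ∑ i, ∑ j, coeffB ε ψ hψ i j q * X i * Y j := by
  have e1 : ((0, X, 0) : ℝ × Coord m × Coord m) = ∑ i, X i • (0, bas i, 0) := by
    conv_lhs => rw [sum_bas X]
    simp [Prod.ext_iff, Prod.fst_sum, Prod.snd_sum]
  have e2 : ((0, 0, Y) : ℝ × Coord m × Coord m) = ∑ i, Y i • (0, 0, bas i) := by
    conv_lhs => rw [sum_bas Y]
    simp [Prod.ext_iff, Prod.fst_sum, Prod.snd_sum]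
  rw [e1, e2]
  simp only [map_sum, map_smul, LinearMap.sum_apply, LinearMap.smul_apply, smul_eq_mul,
    coeffB_eq hψ hε hα hq, Finset.mul_sum]
  rw [Finset.sum_comm]
  refine (Finset.sum_congr rfl fun i _ => Finset.sum_congr rfl fun j _ => ?_)
  ring

theorem coeffB_comm (i j : Fin m) : coeffB ε ψ hψ i j q = coeffB ε ψ hψ j i q := by
  rw [coeffB_eq hψ hε hα hq, coeffB_eq hψ hε hα hq]
  exact (isLocalLepage hψ hε hα).pairing_pos_vel_comm (p := (0, q)) hq _ _

/-- By `pairing_bas_acc` the difference `εᵢ - Aᵢ` is a bilinear pairing evaluated at the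
acceleration, and `B` is its matrix. -/
theorem srcCoeff_affine (i : Fin m) (a : Coord m) : srcCoeff ε ψ hψ i (q.1, q.2, a)
    = coeffA ε ψ hψ i q + ∑ j, coeffB ε ψ hψ i j q * a j := by
  have h := pairing_bas_acc hψ hε hα hq i a
  rw [pairing_pos_vel_eq hψ hε hα hq] at h
  have e : ∑ i', ∑ j, coeffB ε ψ hψ i' j q * (bas i : Coord m) i' * a j
      = ∑ j, coeffB ε ψ hψ i j q * a j := by
    rw [Finset.sum_eq_single i]
    · simp
    · intro b _ hb
      simp [hb]
    · simp
  rw [e] at h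
  linarith

omit hα in
theorem fderiv_sum_coeffA (X : Coord m) (w : Coord m × Coord m) :
    fderiv ℝ (fun z : Coord m × Coord m =>
      (∑ i, srcCoeff ε ψ hψ i (z.1, z.2, 0) •
        (EuclideanSpace.proj i : Coord m →L[ℝ] ℝ).toLinearMap) X) q w
      = ∑ i, fderiv ℝ (coeffA ε ψ hψ i) q w * X i := by
  have hd : ∀ i, DifferentiableAt ℝ (coeffA ε ψ hψ i) q := fun i => by
    have hs : ContDiffAt ℝ ∞ (srcCoeff ε ψ hψ i) (q.1, q.2, 0) :=
      ((hε ψ hψ).1 i).contDiffAt ((ψ.open_target.prod isOpen_univ).mem_nhds ⟨hq, trivial⟩)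
    exact DifferentiableAt.comp q (g := srcCoeff ε ψ hψ i)
      (f := fun q : Coord m × Coord m => (q.1, q.2, (0 : Coord m)))
      (hs.differentiableAt (by simp)) (by fun_prop)
  have e : (fun z : Coord m × Coord m =>
      (∑ i, srcCoeff ε ψ hψ i (z.1, z.2, 0) •
        (EuclideanSpace.proj i : Coord m →L[ℝ] ℝ).toLinearMap) X)
      = fun z => ∑ i, coeffA ε ψ hψ i z * X i := by
    funext z
    simp [coeffA]
  rw [e, fderiv_fun_sum fun i _ => (hd i).mul_const _]
  simp only [sum_apply]
  refine Finset.sum_congr rfl fun i _ => ?_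
  rw [fderiv_mul_const (hd i)]
  simp [mul_comm]

theorem pairing_pos_pos_eq (X Y : Coord m) :
    pairing (DForm.coordExpr (withTime (param1 ψ)) α ((0 : ℝ), q)) (0, X, 0) (0, Y, 0)
      = ∑ i, ∑ j, 1 / 2 * curlA ε ψ hψ i j q * X i * Y j := by
  have h := (isLocalLepage hψ hε hα).two_mul_pairing_pos_pos (p := (0, q)) hq X Y
  rw [fderiv_sum_coeffA hψ hε hq, fderiv_sum_coeffA hψ hε hq] at h
  have hv : ∀ (i : Fin m) (Z : Coord m), fderiv ℝ (coeffA ε ψ hψ i) q (0, Z)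
      = ∑ j, Z j * fderiv ℝ (coeffA ε ψ hψ i) q (0, bas j) := fun i Z => by
    have e : ((0, Z) : Coord m × Coord m) = ∑ j, Z j • (0, bas j) := by
      conv_lhs => rw [sum_bas Z]
      simp [Prod.ext_iff, Prod.fst_sum, Prod.snd_sum]
    rw [e]
    simp only [map_sum, map_smul, smul_eq_mul]
  have e1 : ∑ i, fderiv ℝ (coeffA ε ψ hψ i) q (0, Y) * X i
      = ∑ i, ∑ j, fderiv ℝ (coeffA ε ψ hψ i) q (0, bas j) * X i * Y j := by
    refine Finset.sum_congr rfl fun i _ => ?_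
    rw [hv, Finset.sum_mul]
    refine Finset.sum_congr rfl fun j _ => by ring
  have e2 : ∑ i, fderiv ℝ (coeffA ε ψ hψ i) q (0, X) * Y i
      = ∑ i, ∑ j, fderiv ℝ (coeffA ε ψ hψ j) q (0, bas i) * X i * Y j := by
    rw [Finset.sum_comm]
    refine Finset.sum_congr rfl fun i _ => ?_
    rw [hv, Finset.sum_mul]
    refine Finset.sum_congr rfl fun j _ => by ring
  rw [e1, e2, ← Finset.sum_sub_distrib] at h
  simp only [← Finset.sum_sub_distrib] at h
  have e3 : ∑ i, ∑ j, 1 / 2 * curlA ε ψ hψ i j q * X i * Y j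
      = 1 / 2 * ∑ i, ∑ j, (fderiv ℝ (coeffA ε ψ hψ i) q (0, bas j) * X i * Y j
        - fderiv ℝ (coeffA ε ψ hψ j) q (0, bas i) * X i * Y j) := by
    simp only [Finset.mul_sum]
    refine Finset.sum_congr rfl fun i _ => Finset.sum_congr rfl fun j _ => ?_
    rw [curlA]
    ring
  rw [e3, ← h]
  ring

theorem linForm_coordExpr_timePart :
    linForm (DForm.coordExpr (param1 ψ) (timePart α) q) =
      ∑ i, (coeffA ε ψ hψ i q - 1 / 2 * ∑ j, curlA ε ψ hψ i j q * q.2 j) • dx i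
        + ∑ i, (∑ j, coeffB ε ψ hψ i j q * q.2 j) • dv i := by
  have hl := isLocalLepage hψ hε hα
  rw [coordExpr_timePart α ((contMDiffAt_param1 hψ hq).mdifferentiableAt (by simp)),
    linForm_oneForm]
  refine ContinuousLinearMap.ext fun ξ => ?_
  obtain ⟨X, Y⟩ := ξ
  have h1 := hl.pairing_time (p := (0, q)) hq X Y
  rw [velField_apply, hl.pairing_space (p := (0, q)) hq, pairing_pos_pos_eq hψ hε hα hq,
    pairing_pos_vel_eq hψ hε hα hq, pairing_pos_vel_eq hψ hε hα hq] at h1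
  rw [timeContraction_apply]
  refine h1.trans ?_
  -- The contraction produces `Bᵢⱼ x'ⁱ dx'ʲ`; the symmetry of `B` turns it into the stated `Bᵢⱼ x'ʲ
  -- dx'ⁱ`.
  have e1 : ∑ i, ∑ j, coeffB ε ψ hψ i j q * q.2 i * Y j
      = ∑ i, (∑ j, coeffB ε ψ hψ i j q * q.2 j) * Y i := by
    rw [Finset.sum_comm]
    refine Finset.sum_congr rfl fun i _ => ?_
    rw [Finset.sum_mul]
    refine Finset.sum_congr rfl fun j _ => ?_
    rw [coeffB_comm hψ hε hα hq]
  have e2 : ∑ i, (coeffA ε ψ hψ i q - 1 / 2 * ∑ j, curlA ε ψ hψ i j q * q.2 j) * X i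
      = ∑ i, coeffA ε ψ hψ i q * X i
        - ∑ i, ∑ j, 1 / 2 * curlA ε ψ hψ i j q * X i * q.2 j := by
    rw [← Finset.sum_sub_distrib]
    refine Finset.sum_congr rfl fun i _ => ?_
    rw [sub_mul, Finset.mul_sum, Finset.sum_mul]
    refine congrArg _ (Finset.sum_congr rfl fun j _ => by ring)
  have e3 : (∑ i, srcCoeff ε ψ hψ i (q.1, q.2, 0) •
      (EuclideanSpace.proj i : Coord m →L[ℝ] ℝ).toLinearMap) X
      = ∑ i, coeffA ε ψ hψ i q * X i := by
    simp [coeffA]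
  have e4 : (∑ i, (coeffA ε ψ hψ i q - 1 / 2 * ∑ j, curlA ε ψ hψ i j q * q.2 j) • dx i
      + ∑ i, (∑ j, coeffB ε ψ hψ i j q * q.2 j) • dv i : Coord m × Coord m →L[ℝ] ℝ) (X, Y)
      = ∑ i, (coeffA ε ψ hψ i q - 1 / 2 * ∑ j, curlA ε ψ hψ i j q * q.2 j) * X i
        + ∑ i, (∑ j, coeffB ε ψ hψ i j q * q.2 j) * Y i := by
    simp [dx_apply, dv_apply]
  rw [e4, e2, ← e1]
  refine (congrArg (· - _) e3).trans ?_
  simp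
  ring

theorem coordExpr_spacePart_eq :
    DForm.coordExpr (param1 ψ) (spacePart α) q =
      ∑ i, ∑ j, (1 / 4 * curlA ε ψ hψ i j q) • wedge (dx i) (dx j)
        + ∑ i, ∑ j, coeffB ε ψ hψ i j q • wedge (dx i) (dv j) := by
  have hl := isLocalLepage hψ hε hα
  rw [coordExpr_spacePart α ((contMDiffAt_param1 hψ hq).mdifferentiableAt (by simp))]
  refine form_two_ext fun u v => ?_
  obtain ⟨X, Y⟩ := u
  obtain ⟨X', Y'⟩ := v
  rw [pairing_spaceRestriction, hl.pairing_space (p := (0, q)) hq,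
    pairing_pos_pos_eq hψ hε hα hq, pairing_pos_vel_eq hψ hε hα hq,
    pairing_pos_vel_eq hψ hε hα hq]
  simp only [pairing_add, pairing_sum, pairing_smul, pairing_wedge]
  have e1 : ∑ i, ∑ j, 1 / 4 * curlA ε ψ hψ i j q * X' i * X j
      = -∑ i, ∑ j, 1 / 4 * curlA ε ψ hψ i j q * X i * X' j := by
    rw [Finset.sum_comm, ← Finset.sum_neg_distrib]
    refine Finset.sum_congr rfl fun i _ => ?_
    rw [← Finset.sum_neg_distrib]
    refine Finset.sum_congr rfl fun j _ => ?_
    rw [curlA_swap hψ j i]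
    ring
  have e2 : ∑ i, ∑ j, 1 / 4 * curlA ε ψ hψ i j q *
      (dx i (X, Y) * dx j (X', Y') - dx i (X', Y') * dx j (X, Y))
      = ∑ i, ∑ j, 1 / 4 * curlA ε ψ hψ i j q * X i * X' j
        - ∑ i, ∑ j, 1 / 4 * curlA ε ψ hψ i j q * X' i * X j := by
    simp only [← Finset.sum_sub_distrib]
    refine Finset.sum_congr rfl fun i _ => Finset.sum_congr rfl fun j _ => ?_
    simp only [dx_apply]
    ring
  have e3 : ∑ i, ∑ j, coeffB ε ψ hψ i j q *
      (dx i (X, Y) * dv j (X', Y') - dx i (X', Y') * dv j (X, Y))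
      = ∑ i, ∑ j, coeffB ε ψ hψ i j q * X i * Y' j
        - ∑ i, ∑ j, coeffB ε ψ hψ i j q * X' i * Y j := by
    simp only [← Finset.sum_sub_distrib]
    refine Finset.sum_congr rfl fun i _ => Finset.sum_congr rfl fun j _ => ?_
    simp only [dx_apply, dv_apply]
    ring
  -- The components of `β` at `dx ∧ dx` carry the factor `1/2`. Summing `dxⁱ ∧ dxʲ` over all ordered
  -- pairs counts each twice, whence the `1/4`.
  have e4 : ∑ i, ∑ j, 1 / 2 * curlA ε ψ hψ i j q * X i * X' j
      = 2 * ∑ i, ∑ j, 1 / 4 * curlA ε ψ hψ i j q * X i * X' j := by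
    simp only [Finset.mul_sum]
    refine Finset.sum_congr rfl fun i _ => Finset.sum_congr rfl fun j _ => by ring
  rw [e2, e3, e1, e4]
  ring

end Formulas

end LepageMech

end

open LepageMech

theorem mainTheorem5 {m : ℕ} (hm : 2 ≤ m) {M : Type*} [TopologicalSpace M]
    [ChartedSpace (Coord m) M] [IsManifold (𝓡 m) ∞ M]
    (ε : FormRT2M m M 2) (hε : IsSourceForm ε) (hvar : IsLocallyVariational ε)
    (α : FormRTM m M 2) (hα : IsLepageEquivalent ε α) :
    (∃! d : FormTM m M 1 × FormTM m M 2, IsClosedDecomposition α d.1 d.2) ∧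
    ∀ (α₀ : FormTM m M 1) (α' : FormTM m M 2), IsClosedDecomposition α α₀ α' →
      ∀ (ψ : OpenPartialHomeomorph M (Coord m)) (hψ : ψ ∈ charts m M),
      ∀ q : Coord m × Coord m, q.1 ∈ ψ.target →
        (∀ (i : Fin m) (a : Coord m), srcCoeff ε ψ hψ i (q.1, q.2, a) =
          coeffA ε ψ hψ i q + ∑ j, coeffB ε ψ hψ i j q * a j) ∧
        linForm (DForm.coordExpr (param1 ψ) α₀ q) =
          ∑ i, (coeffA ε ψ hψ i q - 1 / 2 * ∑ j, curlA ε ψ hψ i j q * q.2 j) • dx i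
            + ∑ i, (∑ j, coeffB ε ψ hψ i j q * q.2 j) • dv i ∧
        DForm.coordExpr (param1 ψ) α' q =
          ∑ i, ∑ j, (1 / 4 * curlA ε ψ hψ i j q) • wedge (dx i) (dx j)
            + ∑ i, ∑ j, coeffB ε ψ hψ i j q • wedge (dx i) (dv j) := by
  refine ⟨⟨(timePart α, spacePart α), isClosedDecomposition_parts hε hα, fun d hd => ?_⟩, ?_⟩
  · exact Prod.ext_iff.2 (eq_parts_of_isClosedDecomposition hd)
  · intro α₀ α' h ψ hψ q hq
    obtain ⟨rfl, rfl⟩ := eq_parts_of_isClosedDecomposition h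
    exact ⟨srcCoeff_affine hψ hε hα hq, linForm_coordExpr_timePart hψ hε hα hq,
      coordExpr_spacePart_eq hψ hε hα hq⟩
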